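/- Let $(V,Y,\mathbf 1,\omega)$ be a vertex operator algebra over $\mathbb C$, $V=\bigoplus_{n\in\mathbb Z}V_n$ its decomposition into $L(0)$-eigenspaces (write $\mathrm{wt}\,a=n$ for $a\in V_n$), and $g$ an automorphism of $V$ of finite order $T$. For $0\le r\le T-1$ put $V^r=\{v\in V\mid gv=e^{2\pi i r/T}v\}$, and let $\delta_r=1$ if $r=0$ and $\delta_r=0$ otherwise. For homogeneous $u\in V^r$ and $v\in V$ set $$u\circ_g v=\mathrm{Res}_z\frac{(1+z)^{\mathrm{wt}\,u-1+\delta_r+r/T}}{z^{1+\delta_r}}Y(u,z)v,\qquad u*_gv=\begin{cases}\mathrm{Res}_z\,\dfrac{(1+z)^{\mathrm{wt}\,u}}{z}\,Y(u,z)v & r=0,\\ 0 & r>0,\end{cases}$$ and extend $*_g$ bilinearly to $V$. Let $O_g(V)$ be the linear span of all $u\circ_g v$, and $A_g(V)=V/O_g(V)$. A weak $g$-twisted $V$-module is a complex vector space $M$ with a linear map $v\mapsto Y_M(v,z)=\sum_{n\in\mathbb Q}v_nz^{-n-1}$, $v_n\in\mathrm{End}\,M$, such that for $0\le r\le T-1$,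 $u\in V^r$, $v\in V$, $w\in M$: $u_n=0$ unless $n\in\frac rT+\mathbb Z$; $v_lw=0$ for $l\gg0$; $Y_M(\mathbf 1,z)=1$; and the twisted Jacobi identity $$z_0^{-1}\delta\!\left(\tfrac{z_1-z_2}{z_0}\right)Y_M(u,z_1)Y_M(v,z_2)-z_0^{-1}\delta\!\left(\tfrac{z_2-z_1}{-z_0}\right)Y_M(v,z_2)Y_M(u,z_1)=z_2^{-1}\left(\tfrac{z_1-z_0}{z_2}\right)^{-r/T}\delta\!\left(\tfrac{z_1-z_0}{z_2}\right)Y_M(Y(u,z_0)v,z_2)$$ holds. Let $\mathcal L(V,g)=\bigoplus_{r=0}^{T-1}t^{r/T}\mathbb C[t,t^{-1}]\otimes V^r$, $D=\frac{d}{dt}\otimes1+1\otimes L(-1)$ and $V[g]=\mathcal L(V,g)/D\mathcal L(V,g)$; write $a(q)$ for the image of $t^q\otimes a$ in $V[g]$, which for homogeneous $a$ has degree $\mathrm{wt}\,a-q-1$. Let $V[g]_-$ be the span of the elements $a(q)$ of negative degree, and for homogeneous $a\in V^0$ put $o(a)=a(\mathrm{wt}\,a-1)$. On a weak $g$-twisted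 $V$-module $M$, $V[g]$ acts by $a(q)\mapsto a_q$. Put $\Omega(M)=\{w\in M\mid V[g]_-w=0\}$. **Theorem.** The product $*_g$ induces on $A_g(V)$ the structure of an associative algebra with unit $\mathbf 1+O_g(V)$, and for every weak $g$-twisted $V$-module $M$ there is a representation of this algebra on $\Omega(M)$ (unit acting as the identity) in which, for each homogeneous $a\in V^0$, the class $a+O_g(V)$ acts as $o(a)$. -/

import Mathlib

open scoped VertexOperator

noncomputable section

/-- A vertex operator algebra structure on the complex vector space `V`: the vertex operator map
`Y(u, z) = ∑ u_n z^{-n-1}` (where `u_n` is written `(Y u)[[n]]`), the vacuum `𝟏` and the Virasoro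
(conformal) vector `ω`. The truncation condition `u_n v = 0` for `n ≫ 0` is part of the type
`VertexOperator ℂ V`. With `L(n) = ω_{n+1}`, the homogeneous subspace `V_n` of weight `n` is the
eigenspace of `L(0)` for the eigenvalue `n`. -/
structure VertexOperatorAlgebra (V : Type*) [AddCommGroup V] [Module ℂ V] where
  /-- the vertex operator map -/
  Y : V →ₗ[ℂ] VertexOperator ℂ V
  /-- the vacuum vector -/
  vac : V
  /-- the conformal vector -/
  omega : V
  /-- the rank (central charge) -/
  rank : ℂ
  /-- `Y(𝟏, z) = id` -/
  vac_mode : ∀ n : ℤ, (Y vac)[[n]] = if n = -1 then 1 else 0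
  /-- `Y(u, z)𝟏` is a power series in `z` ... -/
  mode_vac_of_nonneg : ∀ (u : V) (n : ℤ), 0 ≤ n → ((Y u)[[n]]) vac = 0
  /-- ... with constant term `u` -/
  mode_vac : ∀ u : V, ((Y u)[[-1]]) vac = u
  /-- the Jacobi identity: the coefficient of `z₀^{-l-1} z₁^{-m-1} z₂^{-n-1}` in
  `z₀⁻¹ δ((z₁ - z₂)/z₀) Y(u,z₁) Y(v,z₂) w - z₀⁻¹ δ((z₂ - z₁)/(-z₀)) Y(v,z₂) Y(u,z₁) w
    = z₂⁻¹ δ((z₁ - z₀)/z₂) Y(Y(u,z₀)v,z₂) w`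
  (all three sums are finite, by truncation) -/
  jacobi : ∀ (u v w : V) (l m n : ℤ),
    (∑ᶠ i : ℕ, ((-1 : ℂ) ^ i * Ring.choose (l : ℂ) i) •
        ((Y u)[[m + l - i]]) (((Y v)[[n + i]]) w))
      - (∑ᶠ i : ℕ, ((-1 : ℂ) ^ l * (-1 : ℂ) ^ i * Ring.choose (l : ℂ) i) •
        ((Y v)[[n + l - i]]) (((Y u)[[m + i]]) w))
    = ∑ᶠ i : ℕ, Ring.choose (m : ℂ) i • ((Y (((Y u)[[l + i]]) v))[[m + n - i]]) w
  /-- the Virasoro relations for `L(n) = ω_{n+1}` -/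
  virasoro : ∀ m n : ℤ,
    (Y omega)[[m + 1]] * (Y omega)[[n + 1]] - (Y omega)[[n + 1]] * (Y omega)[[m + 1]]
      = ((m : ℂ) - n) • (Y omega)[[m + n + 1]]
        + (if m + n = 0 then ((m : ℂ) ^ 3 - m) / 12 * rank else 0) • (1 : Module.End ℂ V)
  /-- `d/dz Y(u, z) = Y(L(-1)u, z)` -/
  derivative : ∀ (u : V) (n : ℤ), (Y (((Y omega)[[0]]) u))[[n]] = (-(n : ℂ)) • (Y u)[[n - 1]]
  /-- `V` is the direct sum of the spaces `V_n`, `n ∈ ℤ` -/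
  isInternal : DirectSum.IsInternal
    (fun n : ℤ => Module.End.eigenspace ((Y omega)[[1]]) (n : ℂ))
  /-- each `V_n` is finite dimensional -/
  finiteDimensional : ∀ n : ℤ,
    FiniteDimensional ℂ (Module.End.eigenspace ((Y omega)[[1]]) (n : ℂ))
  /-- `V_n = 0` for `n` sufficiently small -/
  bounded_below : ∃ N : ℤ, ∀ n < N, Module.End.eigenspace ((Y omega)[[1]]) (n : ℂ) = ⊥

namespace VertexOperatorAlgebra

variable {V : Type*} [AddCommGroup V] [Module ℂ V]

/-- The mode `u_n`, an endomorphism of `V`. -/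
def mode (A : VertexOperatorAlgebra V) (u : V) (n : ℤ) : Module.End ℂ V := (A.Y u)[[n]]

/-- The space `V_n` of homogeneous vectors of weight `n`. -/
def weightSpace (A : VertexOperatorAlgebra V) (n : ℤ) : Submodule ℂ V :=
  Module.End.eigenspace (A.mode A.omega 1) (n : ℂ)

theorem bijective_coeLinearMap (A : VertexOperatorAlgebra V) :
    Function.Bijective (DirectSum.coeLinearMap fun k => A.weightSpace k) := A.isInternal

/-- The projection of `V = ⨁ V_n` onto `V_n`. -/
def weightProj (A : VertexOperatorAlgebra V) (n : ℤ) : V →ₗ[ℂ] V :=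
  (A.weightSpace n).subtype ∘ₗ DirectSum.component ℂ ℤ (fun k => A.weightSpace k) n ∘ₗ
    (LinearEquiv.ofBijective (DirectSum.coeLinearMap fun k => A.weightSpace k)
      A.bijective_coeLinearMap).symm.toLinearMap

/-- `g` is an automorphism of the vertex operator algebra. -/
structure IsAutomorphism (A : VertexOperatorAlgebra V) (g : V ≃ₗ[ℂ] V) : Prop where
  map_mode : ∀ (u v : V) (n : ℤ), g (A.mode u n v) = A.mode (g u) n (g v)
  map_vac : g A.vac = A.vac
  map_omega : g A.omega = A.omega

end VertexOperatorAlgebra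

section Twisted

variable {V : Type*} [AddCommGroup V] [Module ℂ V]

/-- `V^r = {v | g v = e^{2πir/T} v}`, where `T` is the order of `g`. -/
def gEigen (g : V ≃ₗ[ℂ] V) (r : ℕ) : Submodule ℂ V :=
  Module.End.eigenspace g.toLinearMap
    (Complex.exp (2 * Real.pi * Complex.I * r / (orderOf g : ℂ)))

/-- The projection of `V = ⨁ V^r` onto `V^0`, for `g` of finite order `T`:
the average of `1, g, …, g^{T-1}`. -/
def invariantProj (g : V ≃ₗ[ℂ] V) : V →ₗ[ℂ] V :=
  (orderOf g : ℂ)⁻¹ • ∑ k ∈ Finset.range (orderOf g), (g ^ k).toLinearMap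

namespace VertexOperatorAlgebra

/-- For `u ∈ V^r` of weight `n`,
`u ∘_g v = Res_z (1+z)^{n-1+δ_r+r/T} z^{-1-δ_r} Y(u,z)v`, where `δ_r` is `1` if `r = 0` and
`0` otherwise. -/
def circ (A : VertexOperatorAlgebra V) (g : V ≃ₗ[ℂ] V) (n : ℤ) (r : ℕ) (u v : V) : V :=
  ∑ᶠ i : ℕ,
    Ring.choose ((n : ℂ) - 1 + (if r = 0 then 1 else 0) + (r : ℂ) / (orderOf g : ℂ)) i •
      A.mode u ((i : ℤ) - 1 - (if r = 0 then 1 else 0)) v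

/-- `O_g(V)`, the span of all `u ∘_g v` with `u ∈ V^r` homogeneous, `0 ≤ r < T`, and `v ∈ V`. -/
def Og (A : VertexOperatorAlgebra V) (g : V ≃ₗ[ℂ] V) : Submodule ℂ V :=
  Submodule.span ℂ {x | ∃ (n : ℤ) (r : ℕ) (u v : V), r < orderOf g ∧
    u ∈ A.weightSpace n ∧ u ∈ gEigen g r ∧ x = A.circ g n r u v}

/-- The quotient space `A_g(V) = V / O_g(V)`. -/
abbrev Ag (A : VertexOperatorAlgebra V) (g : V ≃ₗ[ℂ] V) := V ⧸ A.Og g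

/-- The bilinear product `*_g` on `V`: for `u` of weight `n` in `V^0`,
`u *_g v = Res_z (1+z)^n z⁻¹ Y(u,z)v`, while `u *_g v = 0` for `u ∈ V^r`, `0 < r < T`. For general
`u` it is applied to the components of `u` in `V_n ∩ V^0`, `n ∈ ℤ`. -/
def starProduct (A : VertexOperatorAlgebra V) (g : V ≃ₗ[ℂ] V) (u v : V) : V :=
  ∑ᶠ n : ℤ, ∑ᶠ i : ℕ,
    Ring.choose (n : ℂ) i • A.mode (A.weightProj n (invariantProj g u)) ((i : ℤ) - 1) v

/-- `𝓛(V, g) = ⨁_{0 ≤ r < T} t^{r/T} ℂ[t, t⁻¹] ⊗ V^r`, realised inside the space `ℚ →₀ V` of finite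
sums of `t^q ⊗ a`, where `t^q ⊗ a` is `Finsupp.single q a`. -/
def loopSpace (_A : VertexOperatorAlgebra V) (g : V ≃ₗ[ℂ] V) : Submodule ℂ (ℚ →₀ V) :=
  Submodule.span ℂ {x | ∃ (r : ℕ) (k : ℤ) (a : V), r < orderOf g ∧ a ∈ gEigen g r ∧
    x = Finsupp.single ((r : ℚ) / (orderOf g : ℚ) + k) a}

/-- The operator `D = d/dt ⊗ 1 + 1 ⊗ L(-1)`. -/
def loopD (A : VertexOperatorAlgebra V) : (ℚ →₀ V) →ₗ[ℂ] (ℚ →₀ V) :=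
  Finsupp.lsum ℂ fun q : ℚ =>
    (q : ℂ) • Finsupp.lsingle (q - 1) + Finsupp.lsingle q ∘ₗ A.mode A.omega 0

/-- The space `V[g] = 𝓛(V, g) / D 𝓛(V, g)` underlying the Lie algebra `V[g]`. -/
abbrev Vg (A : VertexOperatorAlgebra V) (g : V ≃ₗ[ℂ] V) :=
  A.loopSpace g ⧸ ((A.loopSpace g).map A.loopD).comap (A.loopSpace g).subtype

/-- `V[g]_-`, spanned by the images `a(q)` of those `t^q ⊗ a ∈ 𝓛(V, g)`, with `a ∈ V^r` homogeneous
and `q ∈ r/T + ℤ`, whose degree `wt a - q - 1` is negative. -/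
def VgNeg (A : VertexOperatorAlgebra V) (g : V ≃ₗ[ℂ] V) : Submodule ℂ (A.Vg g) :=
  Submodule.span ℂ {x | ∃ (n : ℤ) (r : ℕ) (k : ℤ) (a : V) (hr : r < orderOf g)
    (ha : a ∈ gEigen g r), a ∈ A.weightSpace n ∧
    (n : ℚ) - ((r : ℚ) / (orderOf g : ℚ) + k) - 1 < 0 ∧
    x = Submodule.Quotient.mk ⟨Finsupp.single ((r : ℚ) / (orderOf g : ℚ) + k) a,
      Submodule.subset_span ⟨r, k, a, hr, ha, rfl⟩⟩}

theorem single_mem_loopSpace_of_invariant (A : VertexOperatorAlgebra V) {g : V ≃ₗ[ℂ] V}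
    (hg : IsOfFinOrder g) {a : V} (ha : a ∈ gEigen g 0) (k : ℤ) :
    Finsupp.single (k : ℚ) a ∈ A.loopSpace g :=
  Submodule.subset_span ⟨0, k, a, hg.orderOf_pos, ha, by simp⟩

/-- `o(a) = a(wt a - 1) ∈ V[g]`, for `a ∈ V^0` of weight `n`. -/
def o (A : VertexOperatorAlgebra V) {g : V ≃ₗ[ℂ] V} (hg : IsOfFinOrder g) (n : ℤ) (a : V)
    (ha : a ∈ gEigen g 0) : A.Vg g :=
  Submodule.Quotient.mk
    ⟨Finsupp.single ((n - 1 : ℤ) : ℚ) a, A.single_mem_loopSpace_of_invariant hg ha (n - 1)⟩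

/-- `L(-1)a = a_{-2}𝟏`. -/
theorem L_neg_one_eq (A : VertexOperatorAlgebra V) (a : V) :
    A.mode A.omega 0 a = A.mode a (-2) A.vac := by
  have h := LinearMap.congr_fun (A.derivative a (-1)) A.vac
  rw [A.mode_vac] at h
  simpa [mode] using h

end VertexOperatorAlgebra

/-- A weak `g`-twisted `V`-module structure on the complex vector space `M`:
`Y_M(v, z) = ∑_{n ∈ ℚ} v_n z^{-n-1}`, where `v_n` is `mode v n`. -/
structure WeakTwistedModule (A : VertexOperatorAlgebra V) (g : V ≃ₗ[ℂ] V)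
    (M : Type*) [AddCommGroup M] [Module ℂ M] where
  /-- the modes of the vertex operators on `M` -/
  mode : V →ₗ[ℂ] (ℚ → Module.End ℂ M)
  /-- for `u ∈ V^r`, only the `u_n` with `n ∈ r/T + ℤ` occur -/
  mode_eq_zero : ∀ r : ℕ, r < orderOf g → ∀ u ∈ gEigen g r, ∀ n : ℚ,
    (∀ k : ℤ, n ≠ (r : ℚ) / (orderOf g : ℚ) + k) → mode u n = 0
  /-- `v_l w = 0` for `l ≫ 0` -/
  truncation : ∀ (v : V) (w : M), ∃ N : ℚ, ∀ l : ℚ, N ≤ l → mode v l w = 0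
  /-- `Y_M(𝟏, z) = id` -/
  vac_mode : ∀ n : ℚ, mode A.vac n = if n = -1 then 1 else 0
  /-- the twisted Jacobi identity, for `u ∈ V^r`: the coefficient of
  `z₀^{-l-1} z₁^{-m-1} z₂^{-n-1}` in
  `z₀⁻¹ δ((z₁ - z₂)/z₀) Y_M(u,z₁) Y_M(v,z₂) w - z₀⁻¹ δ((z₂ - z₁)/(-z₀)) Y_M(v,z₂) Y_M(u,z₁) w
    = z₂⁻¹ ((z₁ - z₀)/z₂)^{-r/T} δ((z₁ - z₀)/z₂) Y_M(Y(u,z₀)v,z₂) w`,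
  where `l ∈ ℤ`, `m = r/T + k` with `k ∈ ℤ`, and `n ∈ ℚ`
  (for `m ∉ r/T + ℤ` the coefficients on both sides vanish) -/
  jacobi : ∀ r : ℕ, r < orderOf g → ∀ u ∈ gEigen g r, ∀ (v : V) (w : M) (l k : ℤ) (m n : ℚ),
    m = (r : ℚ) / (orderOf g : ℚ) + k →
    (∑ᶠ i : ℕ, ((-1 : ℂ) ^ i * Ring.choose (l : ℂ) i) • mode u (m + l - i) (mode v (n + i) w))
      - (∑ᶠ i : ℕ, ((-1 : ℂ) ^ l * (-1 : ℂ) ^ i * Ring.choose (l : ℂ) i) •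
        mode v (n + l - i) (mode u (m + i) w))
    = ∑ᶠ i : ℕ, Ring.choose (m : ℂ) i • mode (A.mode u (l + i) v) (m + n - i) w

namespace WeakTwistedModule

variable {A : VertexOperatorAlgebra V} {g : V ≃ₗ[ℂ] V} {M : Type*} [AddCommGroup M] [Module ℂ M]

/-- The map `t^q ⊗ a ↦ a_q`. -/
def loopAction (W : WeakTwistedModule A g M) : (ℚ →₀ V) →ₗ[ℂ] Module.End ℂ M :=
  Finsupp.lsum ℂ fun q : ℚ => LinearMap.proj q ∘ₗ W.mode

/-- `(L(-1)a)_q = -q a_{q-1}` for `a ∈ V^r` and `q ∈ r/T + ℤ`. -/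
theorem mode_L_neg_one (W : WeakTwistedModule A g M) {r : ℕ} (hr : r < orderOf g) {a : V}
    (ha : a ∈ gEigen g r) (k : ℤ) {q : ℚ} (hq : q = (r : ℚ) / (orderOf g : ℚ) + k) :
    (q : ℂ) • W.mode a (q - 1) + W.mode (A.mode A.omega 0 a) q = 0 := by
  ext w
  have h := W.jacobi r hr a ha A.vac w (-2) k q 0 hq
  have h1 : ∀ i : ℕ, W.mode A.vac (0 + i) = 0 := fun i => by
    rw [W.vac_mode, if_neg]
    have : (0 : ℚ) ≤ i := Nat.cast_nonneg i
    intro h; linarith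
  have h2 : ∀ i : ℕ, W.mode A.vac (0 + ((-2 : ℤ) : ℚ) - i) = 0 := fun i => by
    rw [W.vac_mode, if_neg]
    have : (0 : ℚ) ≤ i := Nat.cast_nonneg i
    push_cast
    intro h; linarith
  simp only [h1, h2, LinearMap.zero_apply, map_zero, smul_zero, finsum_zero, sub_zero] at h
  rw [finsum_eq_sum_of_support_subset (s := Finset.range 2)] at h
  · have h3 : A.mode a (-1) A.vac = a := A.mode_vac a
    rw [A.L_neg_one_eq]
    simp [Finset.sum_range_succ, h3] at h
    simp [add_comm, ← h]
  · intro i hi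
    by_contra hi'
    have hi2 : 2 ≤ i := by simpa [Nat.lt_iff_add_one_le] using hi'
    have : A.mode a (-2 + i) A.vac = 0 := A.mode_vac_of_nonneg a _ (by omega)
    simp [this] at hi

theorem loopAction_single (W : WeakTwistedModule A g M) (q : ℚ) (a : V) :
    W.loopAction (Finsupp.single q a) = W.mode a q := by
  rw [loopAction, Finsupp.lsum_single]
  rfl

theorem loopAction_loopD (W : WeakTwistedModule A g M) {x : ℚ →₀ V} (hx : x ∈ A.loopSpace g) :
    W.loopAction (A.loopD x) = 0 := by
  induction hx using Submodule.span_induction with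
  | mem x h =>
    obtain ⟨r, k, a, hr, ha, rfl⟩ := h
    have := W.mode_L_neg_one hr ha k rfl
    rw [VertexOperatorAlgebra.loopD, Finsupp.lsum_single]
    simpa only [LinearMap.add_apply, LinearMap.smul_apply, LinearMap.comp_apply,
      Finsupp.lsingle_apply, map_add, map_smul, loopAction_single] using this
  | zero => simp
  | add x y _ _ hx hy => simp [hx, hy]
  | smul c x _ hx => simp [hx]

/-- The action of `V[g]` on `M`, in which `a(q)` acts as `a_q`. -/
def action (W : WeakTwistedModule A g M) : A.Vg g →ₗ[ℂ] Module.End ℂ M :=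
  Submodule.liftQ _ (W.loopAction ∘ₗ (A.loopSpace g).subtype) <| by
    rintro ⟨x, hx⟩ ⟨y, hy, hxy⟩
    have : A.loopD y = x := hxy
    simp [← this, W.loopAction_loopD hy]

/-- `Ω(M) = {w ∈ M | V[g]_- w = 0}`. -/
def Omega (W : WeakTwistedModule A g M) : Submodule ℂ M where
  carrier := {w | ∀ x ∈ A.VgNeg g, W.action x w = 0}
  zero_mem' := by simp
  add_mem' := fun h₁ h₂ x hx => by simp [h₁ x hx, h₂ x hx]
  smul_mem' := fun c w h x hx => by simp [h x hx]

end WeakTwistedModule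

end Twisted

end

/-! All products are residues Res (1+z)^P z^q Y(u,z)v, written `binRes P q u v`. For homogeneous u
put P = wt u - 1 + p. For u ∈ V^r and p ∈ r/T + ℤ the residue lies in O_g(V) as soon as p > 0 and p
+ q < 0 (`binRes_mem_Og`). In the commutator of residues with parameters (p, q) and (p', q') the
vector u_{a+b}v, of weight wt u + wt v - a - b - 1, occurs with parameters (p + p' + a, q + q' - a)
(`binRes_commutator_mem`). Thus p + q is additive and the first parameter is at least p + p', so
whether a commutator lies in O_g(V) is read off from the exponents.

Left multiplication by u ∈ V^0 has (p, q) = (1, -1). By skew-symmetry, right multiplication by v ∈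
V^0 is, modulo O_g(V), the residue of v with (p, q) = (0, -1) (`mkQ_binRes_skew`). Both preserve
O_g(V) (`binRes_mem_Og_of_mem`), so the product descends; they commute modulo O_g(V)
(`binRes_commutator_mem_Og`), which is associativity. The sectors V^r with r > 0 lie in O_g(V).

On Ω(M) one coefficient of the twisted Jacobi identity shows that the zero mode of u ∘_g v vanishes
(`zeroMode_circ`), and another that o(u *_g v) = o(u)o(v) (`zeroMode_starHom`). -/

noncomputable section

/-! ### Binomial identities and the calculus of residues. -/

open PowerSeries in
/-- Absorption: the Hasse derivative of `(1 + X) ^ P * X ^ q`, by the Leibniz rule. -/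
theorem Ring.choose_mul_choose_add_eq (P q : ℂ) (i j : ℕ) :
    Ring.choose P i * Ring.choose ((i : ℂ) + q) j =
      ∑ ab ∈ Finset.HasAntidiagonal.antidiagonal j, (Ring.choose q ab.1 * Ring.choose P ab.2) *
        coeff i (X ^ ab.2 * PowerSeries.binomialSeries ℂ (P - ab.2)) := by
  rw [add_comm, Ring.add_choose_eq j (Commute.all _ _), Finset.mul_sum]
  refine Finset.sum_congr rfl fun ab _ => ?_
  rw [coeff_X_pow_mul', Ring.choose_natCast]
  split_ifs with h
  · have := Ring.choose_smul_choose P h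
    rw [nsmul_eq_mul] at this
    rw [binomialSeries_coeff, smul_eq_mul, mul_one, mul_assoc (Ring.choose q _), ← this]
    ring
  · rw [Nat.choose_eq_zero_of_lt (not_le.mp h)]
    simp

theorem Ring.succ_mul_choose_succ (r : ℂ) (i : ℕ) :
    ((i : ℂ) + 1) * Ring.choose r (i + 1) = r * Ring.choose (r - 1) i := by
  have := Ring.choose_smul_choose r (Nat.succ_le_succ (Nat.zero_le i))
  simpa using this

theorem finsum_eq_sum_range {E : Type*} [AddCommMonoid E] {f : ℕ → E} {N : ℕ}
    (h : ∀ i, N ≤ i → f i = 0) : ∑ᶠ i, f i = ∑ i ∈ Finset.range N, f i := by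
  refine finsum_eq_sum_of_support_subset _ fun i hi => ?_
  by_contra hi'
  exact hi (h i (by simpa using hi'))

namespace VertexOperatorAlgebra

open Filter PowerSeries

variable {V : Type*} [AddCommGroup V] [Module ℂ V] (A : VertexOperatorAlgebra V)

theorem mode_add_left (u u' : V) (n : ℤ) : A.mode (u + u') n = A.mode u n + A.mode u' n := by
  simp [mode]

theorem mode_smul_left (c : ℂ) (u : V) (n : ℤ) : A.mode (c • u) n = c • A.mode u n := by
  simp [mode]

@[simp]
theorem mode_zero_left (n : ℤ) : A.mode 0 n = 0 := by
  simp [mode]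

theorem exists_mode_eq_zero (u v : V) : ∃ N : ℤ, ∀ n, N ≤ n → A.mode u n v = 0 := by
  refine ⟨-(HahnSeries.order ((HahnModule.of ℂ).symm (A.Y u v))), fun n hn => ?_⟩
  exact VertexOperator.ncoeff_eq_zero_of_lt_order _ _ _ (by omega)

theorem eventually_mode_eq_zero (u v : V) (q : ℤ) :
    ∀ᶠ N : ℕ in atTop, ∀ i : ℕ, N ≤ i → A.mode u (i + q) v = 0 := by
  obtain ⟨N, hN⟩ := A.exists_mode_eq_zero u v
  filter_upwards [eventually_ge_atTop (N - q).toNat] with n hn i hi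
  exact hN _ (by omega)

/-- The coefficient l = 0 of the Jacobi identity: `Ring.choose 0 i` vanishes for i > 0. -/
theorem mode_commutator (u v w : V) (m n : ℤ) :
    A.mode u m (A.mode v n w) - A.mode v n (A.mode u m w) =
      ∑ᶠ i : ℕ, Ring.choose (m : ℂ) i • A.mode (A.mode u i v) (m + n - i) w := by
  have h := A.jacobi u v w 0 m n
  rw [finsum_eq_single _ 0, finsum_eq_single _ 0] at h
  · simpa [mode] using h
  · intro i hi
    obtain ⟨j, rfl⟩ := Nat.exists_eq_succ_of_ne_zero hi
    simp [Ring.choose_zero_succ]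
  · intro i hi
    obtain ⟨j, rfl⟩ := Nat.exists_eq_succ_of_ne_zero hi
    simp [Ring.choose_zero_succ]

/-- The residue `Res_z f(z) z^q Y(u, z) v`, for a power series `f`. -/
def res (f : ℂ⟦X⟧) (q : ℤ) : V →ₗ[ℂ] V →ₗ[ℂ] V :=
  have key (u v : V) : (Function.support fun i : ℕ => coeff i f • A.mode u (i + q) v).Finite := by
    obtain ⟨N, hN⟩ := (A.eventually_mode_eq_zero u v q).exists
    refine (Finset.range N).finite_toSet.subset fun i hi => ?_
    by_contra hi'
    exact hi (by simp [hN i (by simpa using hi')])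
  LinearMap.mk₂ ℂ (fun u v => ∑ᶠ i : ℕ, coeff i f • A.mode u (i + q) v)
    (fun u u' v => by
      rw [← finsum_add_distrib (key u v) (key u' v)]
      simp [mode_add_left])
    (fun c u v => by
      rw [smul_finsum' c (key u v)]
      simp [mode_smul_left, smul_comm c])
    (fun u v v' => by
      rw [← finsum_add_distrib (key u v) (key u v')]
      simp)
    (fun c u v => by
      rw [smul_finsum' c (key u v)]
      simp [smul_comm c])

theorem res_apply (f : ℂ⟦X⟧) (q : ℤ) (u v : V) :
    A.res f q u v = ∑ᶠ i : ℕ, coeff i f • A.mode u (i + q) v := rfl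

theorem res_eq_sum {f : ℂ⟦X⟧} {q : ℤ} {u v : V} {N : ℕ}
    (h : ∀ i : ℕ, N ≤ i → A.mode u (i + q) v = 0) :
    A.res f q u v = ∑ i ∈ Finset.range N, coeff i f • A.mode u (i + q) v :=
  finsum_eq_sum_range fun i hi => by simp [h i hi]

theorem res_mem {f : ℂ⟦X⟧} {q : ℤ} {u v : V} {S : Submodule ℂ V}
    (h : ∀ i : ℕ, A.mode u (i + q) v ∈ S) : A.res f q u v ∈ S :=
  finsum_induction (· ∈ S) S.zero_mem (fun _ _ => S.add_mem) fun i => S.smul_mem _ (h i)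

theorem res_add (f h : ℂ⟦X⟧) (q : ℤ) (u v : V) :
    A.res (f + h) q u v = A.res f q u v + A.res h q u v := by
  obtain ⟨N, hN⟩ := (A.eventually_mode_eq_zero u v q).exists
  simp [A.res_eq_sum hN, add_smul, Finset.sum_add_distrib]

theorem res_smul (c : ℂ) (f : ℂ⟦X⟧) (q : ℤ) (u v : V) :
    A.res (c • f) q u v = c • A.res f q u v := by
  obtain ⟨N, hN⟩ := (A.eventually_mode_eq_zero u v q).exists
  simp [A.res_eq_sum hN, mul_smul, Finset.smul_sum]

theorem res_zero (q : ℤ) (u v : V) : A.res 0 q u v = 0 := by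
  simpa using A.res_smul 0 0 q u v

theorem res_sum {ι : Type*} (s : Finset ι) (f : ι → ℂ⟦X⟧) (q : ℤ) (u v : V) :
    A.res (∑ i ∈ s, f i) q u v = ∑ i ∈ s, A.res (f i) q u v := by
  classical
  induction s using Finset.induction_on with
  | empty => simp [res_zero]
  | insert a s ha ih => rw [Finset.sum_insert ha, Finset.sum_insert ha, res_add, ih]

theorem res_X_mul (f : ℂ⟦X⟧) (q : ℤ) (u v : V) :
    A.res (X * f) q u v = A.res f (q + 1) u v := by
  obtain ⟨N, hN, hN'⟩ := ((A.eventually_mode_eq_zero u v q).and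
    (A.eventually_mode_eq_zero u v (q + 1))).exists
  rw [A.res_eq_sum (N := N + 1) fun i hi => hN i (by omega), A.res_eq_sum hN',
    Finset.sum_range_succ']
  simp only [coeff_succ_X_mul, coeff_zero_X_mul, zero_smul, add_zero]
  refine Finset.sum_congr rfl fun i _ => ?_
  congr 3
  push_cast
  ring

theorem res_X_pow_mul (k : ℕ) (f : ℂ⟦X⟧) (q : ℤ) (u v : V) :
    A.res (X ^ k * f) q u v = A.res f (q + k) u v := by
  induction k generalizing q with
  | zero => simp
  | succ k ih =>
    rw [pow_succ', mul_assoc, res_X_mul, ih]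
    congr 3
    push_cast
    ring

/-- Both sums are cut at the same N, and every large N works, so that both orders of composition can
share one square range. -/
theorem eventually_res_res (f h : ℂ⟦X⟧) (q q' : ℤ) (u v w : V) :
    ∀ᶠ N : ℕ in atTop, A.res f q u (A.res h q' v w) =
      ∑ i ∈ Finset.range N, ∑ k ∈ Finset.range N,
        (coeff i f * coeff k h) • A.mode u (i + q) (A.mode v (k + q') w) := by
  obtain ⟨K, hK⟩ := (A.eventually_mode_eq_zero v w q').exists
  filter_upwards [eventually_ge_atTop K, (eventually_all_finset (Finset.range K)).2 fun k _ =>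
    A.eventually_mode_eq_zero u (A.mode v (k + q') w) q] with N hN hN'
  have hN'' : ∀ (k i : ℕ), N ≤ i → A.mode u (i + q) (A.mode v (k + q') w) = 0 := by
    intro k i hi
    by_cases hk : k < K
    · exact hN' k (by simpa using hk) i hi
    · simp [hK k (by omega)]
  rw [A.res_eq_sum (N := N) fun i hi => hK i (hN.trans hi), map_sum, Finset.sum_comm]
  refine Finset.sum_congr rfl fun k _ => ?_
  rw [map_smul, A.res_eq_sum (hN'' k), Finset.smul_sum]
  exact Finset.sum_congr rfl fun i _ => by rw [smul_smul, mul_comm]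

theorem sum_range_smul_add {E : Type*} [AddCommGroup E] [Module ℂ E] (F : ℕ → ℕ → ℂ)
    {y : ℕ → E} {N : ℕ} (hy : ∀ s, N ≤ s → y s = 0) :
    ∑ i ∈ Finset.range N, ∑ k ∈ Finset.range N, F i k • y (i + k) =
      ∑ s ∈ Finset.range N,
        (∑ ab ∈ Finset.HasAntidiagonal.antidiagonal s, F ab.1 ab.2) • y s := by
  simp only [Finset.sum_smul]
  rw [← Finset.sum_product', Finset.sum_sigma']
  symm
  refine Finset.sum_of_injOn (fun x => x.2) ?_ ?_ ?_ ?_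
  · rintro ⟨s, a⟩ hs ⟨s', a'⟩ hs' h
    simp_all
  · rintro ⟨s, a⟩ hs
    simp_all
    omega
  · rintro ⟨i, k⟩ hik hn
    rw [hy _ (by_contra fun hlt => hn ⟨⟨i + k, i, k⟩, by simpa using hlt, rfl⟩), smul_zero]
  · rintro ⟨s, a⟩ hs
    simp at hs
    simp [hs.2]

/-- The series built by `PowerSeries.mk`, times z^(q-j), is the j-th Hasse derivative of f(z) z^q,
which the commutator formula pairs with u_j v. -/
theorem res_commutator (f h : ℂ⟦X⟧) (q q' : ℤ) (u v w : V) :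
    ∃ J : ℕ, A.res f q u (A.res h q' v w) - A.res h q' v (A.res f q u w) =
      ∑ j ∈ Finset.range J,
        A.res (PowerSeries.mk (fun i => coeff i f * Ring.choose ((i : ℂ) + q) j) * h) (q + q' - j)
          (A.mode u j v) w := by
  obtain ⟨J, hJ⟩ := (A.eventually_mode_eq_zero u v 0).exists
  refine ⟨J, ?_⟩
  obtain ⟨N, h1, h2, h3⟩ := ((A.eventually_res_res f h q q' u v w).and
    ((A.eventually_res_res h f q' q v u w).and
      ((eventually_all_finset (Finset.range J)).2 fun j _ =>
        A.eventually_mode_eq_zero (A.mode u j v) w (q + q' - j)))).exists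
  rw [h1, h2, Finset.sum_comm (s := Finset.range N) (t := Finset.range N)
    (f := fun i k => (coeff i h * coeff k f) • A.mode v (i + q') (A.mode u (k + q) w))]
  simp only [← Finset.sum_sub_distrib, mul_comm (coeff _ h), ← smul_sub, mode_commutator]
  have h4 : ∀ m n : ℤ, ∑ᶠ i : ℕ, Ring.choose (m : ℂ) i • A.mode (A.mode u i v) (m + n - i) w =
      ∑ j ∈ Finset.range J, Ring.choose (m : ℂ) j • A.mode (A.mode u j v) (m + n - j) w := by
    refine fun m n => finsum_eq_sum_range fun i hi => ?_
    have := hJ i hi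
    rw [add_zero] at this
    simp [this]
  simp only [h4, Finset.smul_sum]
  rw [Finset.sum_congr rfl fun i _ => Finset.sum_comm, Finset.sum_comm]
  refine Finset.sum_congr rfl fun j hj => ?_
  rw [A.res_eq_sum (h3 j hj)]
  simp only [coeff_mul]
  rw [← sum_range_smul_add (fun a b => coeff a (PowerSeries.mk _) * coeff b h) (h3 j hj)]
  refine Finset.sum_congr rfl fun i _ => Finset.sum_congr rfl fun k _ => ?_
  rw [smul_smul, coeff_mk]
  push_cast
  congr 1
  · ring
  · congr 2
    ring

/-- The residue `Res_z (1 + z)^P z^q Y(u, z) v`. -/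
def binRes (P : ℂ) (q : ℤ) : V →ₗ[ℂ] V →ₗ[ℂ] V := A.res (PowerSeries.binomialSeries ℂ P) q

theorem binRes_apply (P : ℂ) (q : ℤ) (u v : V) :
    A.binRes P q u v = ∑ᶠ i : ℕ, Ring.choose P i • A.mode u (i + q) v := by
  simp [binRes, res_apply]

theorem binRes_mem {P : ℂ} {q : ℤ} {u v : V} {S : Submodule ℂ V}
    (h : ∀ i : ℕ, A.mode u (i + q) v ∈ S) : A.binRes P q u v ∈ S := A.res_mem h

theorem binRes_add_one (P : ℂ) (q : ℤ) (u v : V) :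
    A.binRes (P + 1) q u v = A.binRes P q u v + A.binRes P (q + 1) u v := by
  have : PowerSeries.binomialSeries ℂ (1 : ℂ) = 1 + X := by
    simpa using PowerSeries.binomialSeries_nat (R := ℂ) (A := ℂ) 1
  rw [binRes, binomialSeries_add, this, mul_add, mul_one, res_add, mul_comm, res_X_mul]
  rfl

/-- If all the terms of the commutator formula for `Res_z (1 + z)^P z^q Y(u, z)` and
`Res_z (1 + z)^P' z^q' Y(v, z)` map `w` into a subspace `S`, then so does the commutator. -/
theorem binRes_commutator_mem {S : Submodule ℂ V} (P P' : ℂ) (q q' : ℤ) (u v w : V)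
    (hS : ∀ a b : ℕ, A.binRes (P + P' - b) (q + q' - a) (A.mode u ((a + b : ℕ) : ℤ) v) w ∈ S) :
    A.binRes P q u (A.binRes P' q' v w) - A.binRes P' q' v (A.binRes P q u w) ∈ S := by
  obtain ⟨J, hJ⟩ := A.res_commutator (PowerSeries.binomialSeries ℂ P)
    (PowerSeries.binomialSeries ℂ P') q q' u v w
  simp only [binRes]
  rw [hJ]
  refine S.sum_mem fun j _ => ?_
  -- For f = (1+z)^P, Leibniz splits the j-th Hasse derivative of f z^q into multiples of
  -- (1+z)^(P-b) z^(q-a) with a + b = j.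
  have : (PowerSeries.mk fun i =>
      coeff i (PowerSeries.binomialSeries ℂ P) * Ring.choose ((i : ℂ) + q) j) =
      ∑ ab ∈ Finset.HasAntidiagonal.antidiagonal j, (Ring.choose (q : ℂ) ab.1 * Ring.choose P ab.2) •
        (X ^ ab.2 * PowerSeries.binomialSeries ℂ (P - ab.2)) := by
    ext i
    simp only [coeff_mk, binomialSeries_coeff, smul_eq_mul, mul_one, map_sum, map_smul,
      Ring.choose_mul_choose_add_eq]
  rw [this, Finset.sum_mul, res_sum]
  refine S.sum_mem fun ab hab => ?_
  rw [smul_mul_assoc, res_smul, mul_assoc, ← binomialSeries_add, res_X_pow_mul]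
  refine S.smul_mem _ ?_
  have := hS ab.1 ab.2
  rw [Finset.HasAntidiagonal.mem_antidiagonal] at hab
  rw [hab] at this
  have hP : P - ab.2 + P' = P + P' - ab.2 := by ring
  have hq : q + q' - j + ab.2 = q + q' - ab.1 := by
    rw [← hab]
    push_cast
    ring
  rw [hP, hq]
  exact this

/-- Integration by parts against `(L(-1)u)_n = -n u_{n-1}`. -/
theorem binRes_L_neg_one (P : ℂ) (q : ℤ) (u v : V) :
    A.binRes P q (A.mode A.omega 0 u) v =
      -(P + q) • A.binRes (P - 1) q u v - (q : ℂ) • A.binRes (P - 1) (q - 1) u v := by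
  have h : A.binRes P q (A.mode A.omega 0 u) v =
      A.res (PowerSeries.mk fun i => -((i : ℂ) + q) * Ring.choose P i) (q - 1) u v := by
    rw [binRes_apply, res_apply]
    refine finsum_congr fun i => ?_
    have h : A.mode (A.mode A.omega 0 u) (i + q) = _ := A.derivative u (i + q)
    rw [h, coeff_mk, LinearMap.smul_apply, smul_smul, add_sub_assoc]
    push_cast
    congr 1
    ring
  have h' : (PowerSeries.mk fun i => -((i : ℂ) + q) * Ring.choose P i) =
      -(P + q) • (X * PowerSeries.binomialSeries ℂ (P - 1)) +
        -(q : ℂ) • PowerSeries.binomialSeries ℂ (P - 1) := by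
    ext i
    cases i with
    | zero => simp
    | succ i =>
      have h1 := Ring.succ_mul_choose_succ P i
      have h2 := Ring.choose_succ_succ (P - 1) i
      rw [sub_add_cancel] at h2
      simp only [coeff_mk, map_add, map_smul, coeff_succ_X_mul, binomialSeries_coeff, smul_eq_mul,
        mul_one]
      push_cast
      linear_combination -h1 - (q : ℂ) * h2
  rw [h, h', res_add, res_smul, res_smul, res_X_mul, sub_add_cancel, neg_smul (q : ℂ),
    ← sub_eq_add_neg]
  rfl

end VertexOperatorAlgebra

/-! ### Eigenspaces of an operator of finite order. -/

section Eigenspaces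

variable {V : Type*} [AddCommGroup V] [Module ℂ V] {g : V ≃ₗ[ℂ] V}

theorem exp_two_pi_div_orderOf (g : V ≃ₗ[ℂ] V) (r : ℕ) :
    Complex.exp (2 * Real.pi * Complex.I * r / (orderOf g : ℂ)) =
      Complex.exp (2 * Real.pi * Complex.I / (orderOf g : ℂ)) ^ r := by
  rw [← Complex.exp_nat_mul]
  congr 1
  ring

theorem mem_gEigen {r : ℕ} {u : V} : u ∈ gEigen g r ↔
    g u = Complex.exp (2 * Real.pi * Complex.I / (orderOf g : ℂ)) ^ r • u := by
  rw [gEigen, Module.End.mem_eigenspace_iff, exp_two_pi_div_orderOf]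
  rfl

theorem gEigen_mod (hfin : IsOfFinOrder g) (r : ℕ) : gEigen g (r % orderOf g) = gEigen g r := by
  have h := Complex.isPrimitiveRoot_exp (orderOf g) hfin.orderOf_pos.ne'
  ext u
  rw [mem_gEigen, mem_gEigen]
  conv_rhs => rw [← Nat.mod_add_div r (orderOf g), pow_add, pow_mul, h.pow_eq_one, one_pow, mul_one]

theorem pow_apply_of_mem_gEigen {r : ℕ} {u : V} (hu : u ∈ gEigen g r) (k : ℕ) :
    (g ^ k) u = (Complex.exp (2 * Real.pi * Complex.I / (orderOf g : ℂ)) ^ r) ^ k • u := by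
  induction k with
  | zero => simp
  | succ k ih =>
    rw [pow_succ', LinearEquiv.mul_apply, ih, map_smul, mem_gEigen.1 hu, smul_smul, ← pow_succ]

theorem invariantProj_apply (v : V) :
    invariantProj g v = (orderOf g : ℂ)⁻¹ • ∑ k ∈ Finset.range (orderOf g), (g ^ k) v := by
  simp [invariantProj]

theorem invariantProj_of_mem_zero (hfin : IsOfFinOrder g) {u : V} (hu : u ∈ gEigen g 0) :
    invariantProj g u = u := by
  have : (orderOf g : ℂ) ≠ 0 := Nat.cast_ne_zero.2 hfin.orderOf_pos.ne'
  simp [invariantProj_apply, pow_apply_of_mem_gEigen hu, ← Nat.cast_smul_eq_nsmul ℂ, smul_smul,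
    this]

theorem invariantProj_of_mem_ne_zero {r : ℕ} (hr0 : r ≠ 0) (hr : r < orderOf g) {u : V}
    (hu : u ∈ gEigen g r) : invariantProj g u = 0 := by
  have h := Complex.isPrimitiveRoot_exp (orderOf g) (by omega)
  have h1 := h.pow_ne_one_of_pos_of_lt hr0 hr
  have h2 := geom_sum_mul (Complex.exp (2 * Real.pi * Complex.I / (orderOf g : ℂ)) ^ r) (orderOf g)
  rw [← pow_mul, mul_comm r, pow_mul, h.pow_eq_one, one_pow, sub_self, mul_eq_zero,
    or_iff_left (sub_ne_zero.2 h1)] at h2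
  simp only [invariantProj_apply, pow_apply_of_mem_gEigen hu, ← Finset.sum_smul, h2, zero_smul,
    smul_zero]

/-- Fourier inversion on the cyclic group generated by g. Keeping the components in a g-stable S,
later a weight space, gives simultaneous homogeneity. -/
theorem exists_sum_gEigen (hfin : IsOfFinOrder g) {S : Submodule ℂ V} (hS : ∀ v ∈ S, g v ∈ S)
    {u : V} (hu : u ∈ S) : ∃ f : ℕ → V, (∀ r, f r ∈ S ∧ f r ∈ gEigen g r) ∧
      u = ∑ r ∈ Finset.range (orderOf g), f r := by
  have h := Complex.isPrimitiveRoot_exp (orderOf g) hfin.orderOf_pos.ne'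
  set ζ := Complex.exp (2 * Real.pi * Complex.I / (orderOf g : ℂ)) with hζ
  have hζ0 : ζ ≠ 0 := Complex.exp_ne_zero _
  have hT : (orderOf g : ℂ) ≠ 0 := Nat.cast_ne_zero.2 hfin.orderOf_pos.ne'
  have hpow : ∀ k : ℕ, (g ^ k) u ∈ S := by
    intro k
    induction k with
    | zero => simpa
    | succ k ih =>
      rw [pow_succ', LinearEquiv.mul_apply]
      exact hS _ ih
  refine ⟨fun r => (orderOf g : ℂ)⁻¹ •
    ∑ k ∈ Finset.range (orderOf g), (ζ⁻¹ ^ r) ^ k • (g ^ k) u, fun r => ⟨?_, ?_⟩, ?_⟩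
  · exact S.smul_mem _ (S.sum_mem fun k _ => S.smul_mem _ (hpow k))
  · rw [mem_gEigen, ← hζ, map_smul, map_sum, smul_comm]
    congr 1
    -- The summands for k = 0 and k = T coincide, so the sum is unchanged by the shift k ↦ k + 1.
    have h1 := Finset.sum_range_succ (fun k => (ζ⁻¹ ^ r) ^ k • (g ^ k) u) (orderOf g)
    rw [Finset.sum_range_succ'] at h1
    have h2 : (ζ⁻¹ ^ r) ^ orderOf g = 1 := by
      rw [← pow_mul, mul_comm, pow_mul, inv_pow, h.pow_eq_one, inv_one, one_pow]
    rw [h2, pow_orderOf_eq_one, pow_zero, pow_zero, add_left_inj] at h1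
    rw [← h1, Finset.smul_sum]
    refine Finset.sum_congr rfl fun k _ => ?_
    rw [map_smul, smul_smul, pow_succ' (ζ⁻¹ ^ r), ← mul_assoc, ← mul_pow, mul_inv_cancel₀ hζ0,
      one_pow, one_mul, pow_succ' g, LinearEquiv.mul_apply]
  · rw [← Finset.smul_sum, Finset.sum_comm]
    rw [Finset.sum_eq_single_of_mem 0 (by simpa using hfin.orderOf_pos)]
    · simp [← Nat.cast_smul_eq_nsmul ℂ, smul_smul, hT]
    · intro k hk hk0
      rw [Finset.mem_range] at hk
      have h1 := h.inv.pow_ne_one_of_pos_of_lt hk0 hk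
      have h2 := geom_sum_mul (ζ⁻¹ ^ k) (orderOf g)
      rw [← pow_mul, mul_comm k, pow_mul, h.inv.pow_eq_one, one_pow, sub_self, mul_eq_zero,
        or_iff_left (sub_ne_zero.2 h1)] at h2
      simp only [← Finset.sum_smul, ← pow_mul, mul_comm _ k] at h2 ⊢
      rw [h2, zero_smul]

end Eigenspaces

/-! ### The weight grading, its compatibility with g, and reduction to homogeneous vectors. -/

namespace VertexOperatorAlgebra

variable {V : Type*} [AddCommGroup V] [Module ℂ V] (A : VertexOperatorAlgebra V)

variable {A} in
theorem mem_weightSpace {n : ℤ} {u : V} :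
    u ∈ A.weightSpace n ↔ A.mode A.omega 1 u = (n : ℂ) • u :=
  Module.End.mem_eigenspace_iff

theorem mode_L_neg_one (u : V) (n : ℤ) :
    A.mode (A.mode A.omega 0 u) n = (-(n : ℂ)) • A.mode u (n - 1) := A.derivative u n

theorem mode_vac_vac (n : ℤ) (v : V) : A.mode A.vac n v = if n = -1 then v else 0 := by
  rw [mode, A.vac_mode]
  split_ifs <;> rfl

theorem mode_neg_one_vac (u : V) : A.mode u (-1) A.vac = u := A.mode_vac u

variable {A} {n m : ℤ} {u v : V}

theorem L_neg_one_mem_weightSpace (hu : u ∈ A.weightSpace n) :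
    A.mode A.omega 0 u ∈ A.weightSpace (n + 1) := by
  have h := LinearMap.congr_fun (A.virasoro 0 (-1)) u
  rw [mem_weightSpace] at hu ⊢
  simp [mode] at h hu ⊢
  rw [hu, map_smul, sub_eq_iff_eq_add] at h
  rw [h, add_smul, one_smul, add_comm]

/-- In [L(0), u_k] only (L(-1)u)_{k+1} = -(k+1)u_k and (L(0)u)_k = n u_k survive. -/
theorem mode_mem_weightSpace (hu : u ∈ A.weightSpace n) (hv : v ∈ A.weightSpace m) (k : ℤ) :
    A.mode u k v ∈ A.weightSpace (n + m - k - 1) := by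
  have h := A.mode_commutator A.omega u v 1 k
  rw [finsum_eq_sum_range (N := 2)] at h
  · rw [mem_weightSpace] at hu hv ⊢
    simp only [Finset.sum_range_succ, Finset.sum_range_zero, Nat.cast_zero, Nat.cast_one,
      Int.cast_one, Ring.choose_zero_right, Ring.choose_one_right, one_smul, zero_add, hu, hv,
      map_smul, mode_L_neg_one, mode_smul_left, LinearMap.smul_apply, sub_zero,
      add_sub_cancel_left] at h
    rw [sub_eq_iff_eq_add] at h
    rw [h, ← add_smul, ← add_smul]
    push_cast
    congr 1
    ring
  · intro i hi
    have h1 : Ring.choose (((1 : ℤ) : ℂ)) i = 0 := by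
      have := Ring.choose_natCast (R := ℂ) 1 i
      rw [Nat.choose_eq_zero_of_lt (by omega)] at this
      simpa using this
    rw [h1, zero_smul]

theorem vac_mem_weightSpace : A.vac ∈ A.weightSpace 0 := by
  rw [mem_weightSpace]
  simpa [mode] using A.mode_vac_of_nonneg A.omega 1 (by norm_num)

theorem weightProj_coe (d : DirectSum ℤ fun k => A.weightSpace k) :
    A.weightProj n (DirectSum.coeLinearMap (fun k => A.weightSpace k) d) = d n := by
  have h : (LinearEquiv.ofBijective (DirectSum.coeLinearMap fun k => A.weightSpace k)
      A.bijective_coeLinearMap).symm (DirectSum.coeLinearMap (fun k => A.weightSpace k) d) = d :=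
    LinearEquiv.ofBijective_symm_apply_apply _ d
  rw [weightProj, LinearMap.comp_apply, LinearMap.comp_apply, LinearEquiv.coe_coe, h]
  rfl

theorem weightProj_of_mem (hu : u ∈ A.weightSpace n) :
    A.weightProj m u = if n = m then u else 0 := by
  have h := weightProj_coe (n := m) (DirectSum.lof ℂ ℤ (fun k => A.weightSpace k) n ⟨u, hu⟩)
  rw [DirectSum.coeLinearMap_lof] at h
  change A.weightProj m u = _ at h
  rw [h, DirectSum.lof_eq_of]
  split_ifs with hnm
  · subst hnm
    rw [DirectSum.of_eq_same]
  · rw [DirectSum.of_eq_of_ne _ _ _ (Ne.symm hnm)]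
    rfl

variable {g : V ≃ₗ[ℂ] V} {r s : ℕ}

theorem mode_mem_gEigen (hg : A.IsAutomorphism g) (hu : u ∈ gEigen g r) (hv : v ∈ gEigen g s)
    (k : ℤ) : A.mode u k v ∈ gEigen g (r + s) := by
  rw [mem_gEigen] at hu hv ⊢
  rw [hg.map_mode, hu, hv, mode_smul_left, LinearMap.smul_apply, map_smul, smul_smul, pow_add]

theorem vac_mem_gEigen (hg : A.IsAutomorphism g) : A.vac ∈ gEigen g 0 := by
  simp [mem_gEigen, hg.map_vac]

theorem L_neg_one_mem_gEigen (hg : A.IsAutomorphism g) (hu : u ∈ gEigen g r) :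
    A.mode A.omega 0 u ∈ gEigen g r := by
  rw [mem_gEigen] at hu ⊢
  rw [hg.map_mode, hu, hg.map_omega, map_smul]

theorem map_mem_weightSpace (hg : A.IsAutomorphism g) (hu : u ∈ A.weightSpace n) :
    g u ∈ A.weightSpace n := by
  rw [mem_weightSpace] at hu ⊢
  rw [← map_smul, ← hu, hg.map_mode, hg.map_omega]

/-- `V` is spanned by the spaces `V_n ∩ V^r`. -/
theorem induction_homogeneous (hg : A.IsAutomorphism g) (hfin : IsOfFinOrder g) {p : V → Prop}
    (hom : ∀ (n : ℤ) (r : ℕ) (u : V), r < orderOf g → u ∈ A.weightSpace n → u ∈ gEigen g r → p u)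
    (zero : p 0) (add : ∀ u v, p u → p v → p (u + v)) (u : V) : p u := by
  have hu : u ∈ ⨆ n, A.weightSpace n := by
    have := A.isInternal.submodule_iSup_eq_top
    change (⨆ n, A.weightSpace n) = ⊤ at this
    rw [this]
    trivial
  refine Submodule.iSup_induction _ (motive := p) hu (fun n u hu => ?_) zero add
  obtain ⟨f, hf, rfl⟩ := exists_sum_gEigen hfin (fun v hv => map_mem_weightSpace hg hv) hu
  exact Finset.sum_induction f p add zero fun r hr =>
    hom n r _ (Finset.mem_range.1 hr) (hf r).1 (hf r).2

/-- Assemble linear maps, one for each weight, into a linear map that is applied to the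
homogeneous components in `V_n ∩ V^0`. -/
def invariantLift (A : VertexOperatorAlgebra V) (g : V ≃ₗ[ℂ] V) {E : Type*} [AddCommGroup E]
    [Module ℂ E] (L : ℤ → V →ₗ[ℂ] E) : V →ₗ[ℂ] E :=
  (DirectSum.toModule ℂ ℤ E fun n => L n ∘ₗ (A.weightSpace n).subtype) ∘ₗ
    (LinearEquiv.ofBijective (DirectSum.coeLinearMap fun k => A.weightSpace k)
      A.bijective_coeLinearMap).symm.toLinearMap ∘ₗ invariantProj g

variable {E : Type*} [AddCommGroup E] [Module ℂ E] (L : ℤ → V →ₗ[ℂ] E)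

theorem invariantLift_eq_finsum (v : V) :
    A.invariantLift g L v = ∑ᶠ n : ℤ, L n (A.weightProj n (invariantProj g v)) := by
  classical
  obtain ⟨d, hd⟩ := A.bijective_coeLinearMap.2 (invariantProj g v)
  have h : (LinearEquiv.ofBijective (DirectSum.coeLinearMap fun k => A.weightSpace k)
      A.bijective_coeLinearMap).symm (DirectSum.coeLinearMap (fun k => A.weightSpace k) d) = d :=
    LinearEquiv.ofBijective_symm_apply_apply _ d
  rw [invariantLift, LinearMap.comp_apply, LinearMap.comp_apply, LinearEquiv.coe_coe, ← hd, h,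
    DirectSum.toModule, DFinsupp.lsum_apply_apply, DFinsupp.sumAddHom_apply, DFinsupp.sum]
  simp only [weightProj_coe]
  rw [finsum_eq_sum_of_support_subset (s := DFinsupp.support d)]
  · rfl
  · intro n hn
    simp only [Finset.mem_coe, DFinsupp.mem_support_iff]
    intro h0
    exact hn (by simp [h0])

theorem invariantLift_of_mem (hfin : IsOfFinOrder g) (hn : u ∈ A.weightSpace n)
    (h0 : u ∈ gEigen g 0) : A.invariantLift g L u = L n u := by
  rw [invariantLift_eq_finsum, invariantProj_of_mem_zero hfin h0, finsum_eq_single _ n]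
  · rw [weightProj_of_mem hn, if_pos rfl]
  · intro m hm
    rw [weightProj_of_mem hn, if_neg (Ne.symm hm), map_zero]

theorem invariantLift_of_mem_ne_zero (hr0 : r ≠ 0) (hr : r < orderOf g) (hu : u ∈ gEigen g r) :
    A.invariantLift g L u = 0 := by
  simp [invariantLift_eq_finsum, invariantProj_of_mem_ne_zero hr0 hr hu]

end VertexOperatorAlgebra

/-! ### Residues lying in O_g(V), and skew-symmetry modulo O_g(V). -/

namespace VertexOperatorAlgebra

variable {V : Type*} [AddCommGroup V] [Module ℂ V] {A : VertexOperatorAlgebra V}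
variable {g : V ≃ₗ[ℂ] V} {n m : ℤ} {r s : ℕ} {u v w : V}

theorem circ_eq_binRes (A : VertexOperatorAlgebra V) (g : V ≃ₗ[ℂ] V) (n : ℤ) (r : ℕ) (u v : V) :
    A.circ g n r u v = A.binRes ((n : ℂ) - 1 + (r : ℂ) / (orderOf g : ℂ) +
      ((if r = 0 then 1 else 0 : ℤ) : ℂ)) (-1 - (if r = 0 then 1 else 0)) u v := by
  rw [circ, binRes_apply]
  refine finsum_congr fun i => ?_
  congr 2
  · push_cast
    ring
  · ring_nf

/-- `Res_z (1 + z)^{n-1+p} z^q Y(u, z)v` lies in `O_g(V)` for `u ∈ V^r` of weight `n`,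
`p ∈ r/T + ℤ`, `p > 0` and `p + q < 0`. -/
theorem binRes_mem_Og (hg : A.IsAutomorphism g) (hr : r < orderOf g) (hn : u ∈ A.weightSpace n)
    (hu : u ∈ gEigen g r) {k q : ℤ} (hk : (if r = 0 then 1 else 0) ≤ k) (hkq : k + q ≤ -1)
    {P : ℂ} (hP : P = (n : ℂ) - 1 + (r : ℂ) / (orderOf g : ℂ) + k) :
    A.binRes P q u v ∈ A.Og g := by
  generalize hδ : (if r = 0 then 1 else 0 : ℤ) = δ at hk
  have hδ0 : 0 ≤ δ := by
    rw [← hδ]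
    split_ifs <;> norm_num
  -- Lowering q: integration by parts expresses the residue of L(-1)u at q through those of u at q
  -- and q - 1, the latter with coefficient -q ≠ 0. The induction hypothesis is applied to L(-1)u,
  -- hence the quantification over n and u.
  have h1 : ∀ (d : ℕ) (n : ℤ) (u : V), u ∈ A.weightSpace n → u ∈ gEigen g r →
      A.binRes ((n : ℂ) - 1 + (r : ℂ) / (orderOf g : ℂ) + δ) (-1 - δ - d) u v ∈ A.Og g := by
    intro d
    induction d with
    | zero =>
      intro n u hn hu
      refine Submodule.subset_span ⟨n, r, u, v, hr, hn, hu, ?_⟩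
      rw [circ_eq_binRes, hδ, Nat.cast_zero, sub_zero]
    | succ d ih =>
      intro n u hn hu
      have h2 := A.binRes_L_neg_one ((n : ℂ) + (r : ℂ) / (orderOf g : ℂ) + δ) (-1 - δ - d) u v
      have h3 := ih _ _ (L_neg_one_mem_weightSpace hn) (L_neg_one_mem_gEigen hg hu)
      have h4 := ih n u hn hu
      have e1 : ((n + 1 : ℤ) : ℂ) - 1 + (r : ℂ) / (orderOf g : ℂ) + δ =
        (n : ℂ) + (r : ℂ) / (orderOf g : ℂ) + δ := by
        push_cast
        ring
      have e2 : (n : ℂ) + (r : ℂ) / (orderOf g : ℂ) + δ - 1 =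
        (n : ℂ) - 1 + (r : ℂ) / (orderOf g : ℂ) + δ := by ring
      rw [e1, h2, e2, Submodule.sub_mem_iff_right _ (Submodule.smul_mem _ _ h4),
        Submodule.smul_mem_iff _ (Int.cast_ne_zero.2 (by omega))] at h3
      convert h3 using 3
      push_cast
      ring_nf
  -- Raising P: one factor 1 + z costs one unit of q, which the bound on q + e pays for.
  have h2 : ∀ (e : ℕ) (q : ℤ), q + e + 1 + δ ≤ 0 →
      A.binRes ((n : ℂ) - 1 + (r : ℂ) / (orderOf g : ℂ) + δ + e) q u v ∈ A.Og g := by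
    intro e
    induction e with
    | zero =>
      intro q hq
      have := h1 (-1 - δ - q).toNat n u hn hu
      rw [Int.toNat_of_nonneg (by push_cast at hq; omega), sub_sub_cancel] at this
      simpa using this
    | succ e ih =>
      intro q hq
      push_cast at hq ⊢
      rw [← add_assoc, binRes_add_one]
      exact Submodule.add_mem _ (ih _ (by omega)) (ih _ (by omega))
  have h3 := h2 (k - δ).toNat q (by omega)
  have e : (((k - δ).toNat : ℕ) : ℂ) = k - δ := by
    rw [← Int.cast_natCast, Int.toNat_of_nonneg (by omega)]
    push_cast
    rfl
  rw [e] at h3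
  convert h3 using 3
  rw [hP]
  ring_nf

theorem binRes_vac_of_neg_one (P : ℂ) (u : V) : A.binRes P (-1) u A.vac = u := by
  rw [binRes_apply, finsum_eq_single _ 0]
  · simp [mode_neg_one_vac]
  · intro i hi
    rw [mode, A.mode_vac_of_nonneg u _ (by omega), smul_zero]

/-- Since δ_r = 0, the simple pole z⁻¹ is allowed, and Res (1+z)^P z⁻¹ Y(u,z)𝟏 = u. -/
theorem mem_Og_of_ne_zero (hg : A.IsAutomorphism g) (hr0 : r ≠ 0) (hr : r < orderOf g)
    (hn : u ∈ A.weightSpace n) (hu : u ∈ gEigen g r) : u ∈ A.Og g := by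
  rw [← A.binRes_vac_of_neg_one _ u]
  exact binRes_mem_Og hg hr hn hu (k := 0) (by simp [hr0]) (by norm_num) rfl

/-- The operators `Res_z (1 + z)^{n-1+p} z⁻¹ Y(u, z)` with `u ∈ V^0` of weight `n` and
`p ∈ {0, 1}` preserve `O_g(V)`. -/
theorem binRes_mem_Og_of_mem (hg : A.IsAutomorphism g) (hn : u ∈ A.weightSpace n)
    (hu : u ∈ gEigen g 0) {p : ℤ} (hp0 : 0 ≤ p) (hp1 : p ≤ 1) {P : ℂ} (hP : P = (n : ℂ) - 1 + p)
    (hv : v ∈ A.Og g) : A.binRes P (-1) u v ∈ A.Og g := by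
  induction hv using Submodule.span_induction with
  | zero => simp
  | add x y _ _ hx hy => simpa using Submodule.add_mem _ hx hy
  | smul c x _ hx => simpa using Submodule.smul_mem _ c hx
  | mem x hx =>
    obtain ⟨m, r, v, w, hr, hm, hv, rfl⟩ := hx
    have h1 : A.circ g m r v (A.binRes P (-1) u w) ∈ A.Og g :=
      Submodule.subset_span ⟨m, r, v, _, hr, hm, hv, rfl⟩
    rw [circ_eq_binRes] at h1 ⊢
    -- Moving the operator past v leaves a generator of O_g(V), so only the commutator is at stake.
    rw [← Submodule.sub_mem_iff_left _ h1]
    refine A.binRes_commutator_mem _ _ _ _ _ _ _ fun a b => ?_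
    have h2 := mode_mem_gEigen hg hu hv ((a + b : ℕ) : ℤ)
    rw [zero_add] at h2
    -- Here k + q = p - 2, which is at most -1 exactly because p ≤ 1.
    refine binRes_mem_Og hg hr (mode_mem_weightSpace hn hm _) h2
      (k := p + (if r = 0 then 1 else 0) + a) (by omega) (by omega) ?_
    rw [hP]
    push_cast
    ring

theorem binRes_commutator_mem_Og (hg : A.IsAutomorphism g) (hfin : IsOfFinOrder g)
    (hn : u ∈ A.weightSpace n) (hu : u ∈ gEigen g 0) (hm : v ∈ A.weightSpace m)
    (hv : v ∈ gEigen g 0) (w : V) :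
    A.binRes n (-1) u (A.binRes ((m : ℂ) - 1) (-1) v w) -
      A.binRes ((m : ℂ) - 1) (-1) v (A.binRes n (-1) u w) ∈ A.Og g := by
  refine A.binRes_commutator_mem _ _ _ _ _ _ _ fun a b => ?_
  refine binRes_mem_Og hg hfin.orderOf_pos (mode_mem_weightSpace hn hm _)
    (mode_mem_gEigen hg hu hv ((a + b : ℕ) : ℤ)) (k := 1 + a) (by simp) (by omega) ?_
  push_cast
  ring

/-- The element is u ∘_g 𝟏 = u_{-2}𝟏 + n u_{-1}𝟏. -/
theorem L_neg_one_add_mem_Og (hg : A.IsAutomorphism g) (hfin : IsOfFinOrder g)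
    (hn : u ∈ A.weightSpace n) (hu : u ∈ gEigen g 0) :
    A.mode A.omega 0 u + (n : ℂ) • u ∈ A.Og g := by
  have h := binRes_mem_Og (v := A.vac) hg hfin.orderOf_pos hn hu (k := 1) (q := -2) (by simp)
    (by norm_num) rfl
  rw [binRes_apply, finsum_eq_sum_range (N := 2)] at h
  · simpa [Finset.sum_range_succ, mode_neg_one_vac, ← A.L_neg_one_eq] using h
  · intro i hi
    rw [mode, A.mode_vac_of_nonneg u _ (by omega), smul_zero]

/-- `u_{-1-i} 𝟏 = L(-1)^i u / i!` is congruent to a multiple of `u` modulo `O_g(V)`. -/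
theorem mkQ_mode_vac (hg : A.IsAutomorphism g) (hfin : IsOfFinOrder g)
    (hn : u ∈ A.weightSpace n) (hu : u ∈ gEigen g 0) (i : ℕ) :
    (A.Og g).mkQ (A.mode u (-1 - i) A.vac) = Ring.choose (-(n : ℂ)) i • (A.Og g).mkQ u := by
  induction i generalizing n u with
  | zero => simp [mode_neg_one_vac]
  | succ i ih =>
    -- The induction passes to L(-1)u, of weight n + 1, through (L(-1)u)_{-1-i} = (i+1)u_{-2-i}.
    have h1 := LinearMap.congr_fun (A.mode_L_neg_one u (-1 - i)) A.vac
    have h2 := ih (L_neg_one_mem_weightSpace hn) (L_neg_one_mem_gEigen hg hu)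
    have h3 : (A.Og g).mkQ (A.mode A.omega 0 u) = (-(n : ℂ)) • (A.Og g).mkQ u := by
      have := (Submodule.Quotient.mk_eq_zero _).2 (L_neg_one_add_mem_Og hg hfin hn hu)
      rw [← Submodule.mkQ_apply, map_add, map_smul] at this
      rw [neg_smul, eq_neg_iff_add_eq_zero, this]
    have h4 := Ring.succ_mul_choose_succ (-(n : ℂ)) i
    have h5 : ((i : ℂ) + 1) ≠ 0 := Nat.cast_add_one_ne_zero i
    rw [h1, h3, LinearMap.smul_apply, map_smul, smul_smul] at h2
    refine smul_right_injective _ h5 ?_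
    simp only [smul_smul]
    rw [h4]
    push_cast at h2 ⊢
    convert h2 using 2
    · ring
    · congr 3
      ring
    · ring_nf

/-- Skew-symmetry, from the Jacobi identity for v, u on 𝟏 with exponents (l, -1, 0): u_i𝟏 = 0 for i
≥ 0 kills the first sum, and v_{-1}𝟏 = v is all that remains of the second. -/
theorem mode_skew (u v : V) (l : ℤ) :
    A.mode u l v = ∑ᶠ i : ℕ, (-(-1 : ℂ) ^ (l + i)) • A.mode (A.mode v (l + i) u) (-1 - i) A.vac := by
  have h := A.jacobi v u A.vac l (-1) 0
  rw [finsum_eq_zero_of_forall_eq_zero, finsum_eq_single _ 0] at h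
  · have h1 : ∀ i : ℕ, Ring.choose (((-1 : ℤ)) : ℂ) i = (-1) ^ i := by
      intro i
      have := Ring.choose_neg' (1 : ℂ) i
      rw [Ring.multichoose_one] at this
      simpa [Int.negOnePow_def, Units.smul_def] using this
    have hl : (-1 : ℂ) ^ l * (-1 : ℂ) ^ l = 1 := by
      rw [← mul_zpow]
      simp
    have h2 : A.mode u l v = (-(-1 : ℂ) ^ l) •
        ∑ᶠ i : ℕ, (-1 : ℂ) ^ i • A.mode (A.mode v (l + i) u) (-1 - i) A.vac := by
      simp only [h1] at h
      have h3 : A.mode v (-1) A.vac = v := A.mode_vac v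
      simp only [mode] at h3 ⊢
      simp only [add_zero] at h
      rw [← h]
      simp [h3, smul_smul, hl]
    rw [h2, smul_finsum]
    refine finsum_congr fun i => ?_
    rw [smul_smul, zpow_add₀ (by norm_num), zpow_natCast, neg_mul]
  · intro i hi
    rw [A.mode_vac_of_nonneg v _ (by omega), map_zero, smul_zero]
  · intro i
    rw [A.mode_vac_of_nonneg u _ (by omega), map_zero, smul_zero]

/-- `u *_g v` is congruent to `Res_z (1 + z)^{wt v - 1} z⁻¹ Y(v, z)u` modulo `O_g(V)`. -/
theorem mkQ_binRes_skew (hg : A.IsAutomorphism g) (hfin : IsOfFinOrder g)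
    (hn : u ∈ A.weightSpace n) (hu : u ∈ gEigen g 0) (hm : v ∈ A.weightSpace m)
    (hv : v ∈ gEigen g 0) :
    (A.Og g).mkQ (A.binRes n (-1) u v) = (A.Og g).mkQ (A.binRes ((m : ℂ) - 1) (-1) v u) := by
  obtain ⟨N, h1, h2⟩ := ((A.eventually_mode_eq_zero u v (-1)).and
    (A.eventually_mode_eq_zero v u (-1))).exists
  have h3 : ∀ a : ℕ, (A.Og g).mkQ (A.mode u (a + -1) v) = ∑ i ∈ Finset.range N,
      ((-1) ^ (a + i) * Ring.choose (((a + i : ℕ) : ℂ) - n - m) i) •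
        (A.Og g).mkQ (A.mode v ((a + i : ℕ) + -1) u) := by
    intro a
    rw [mode_skew, finsum_eq_sum_range (N := N), map_sum]
    · refine Finset.sum_congr rfl fun i _ => ?_
      rw [map_smul, mkQ_mode_vac hg hfin (mode_mem_weightSpace hm hn _)
        (mode_mem_gEigen hg hv hu _), smul_smul]
      have e : (a : ℤ) + -1 + i = ((a + i : ℕ) : ℤ) + -1 := by
        push_cast
        ring
      rw [e]
      congr 2
      · rw [zpow_add₀ (by norm_num), zpow_natCast]
        simp
      · congr 1
        push_cast
        ring
    · intro i hi
      have := h2 (a + i) (by omega)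
      have e : (a : ℤ) + -1 + i = ((a + i : ℕ) : ℤ) + -1 := by
        push_cast
        ring
      rw [e, this]
      simp
  rw [binRes, binRes, A.res_eq_sum h1, A.res_eq_sum h2, map_sum, map_sum]
  simp only [map_smul, h3, Finset.smul_sum, smul_smul, PowerSeries.binomialSeries_coeff,
    smul_eq_mul, mul_one]
  -- Collecting by s = a + i, the coefficient of v_{s-1}u is (-1)^s ∑ C(n,a) C(s-n-m,i).
  rw [sum_range_smul_add
    (fun a i => Ring.choose (n : ℂ) a * ((-1) ^ (a + i) * Ring.choose (((a + i : ℕ) : ℂ) - n - m) i))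
    (y := fun s => (A.Og g).mkQ (A.mode v ((s : ℤ) + -1) u)) fun s hs =>
      by simp only [h2 s hs, map_zero] ]
  refine Finset.sum_congr rfl fun s _ => ?_
  congr 1
  -- By Vandermonde that sum is C(s-m,s), and upper negation turns it into (-1)^s C(m-1,s).
  have h4 := Ring.add_choose_eq s (Commute.all (n : ℂ) ((s : ℂ) - n - m))
  have h5 := Ring.choose_neg ((m : ℂ) - s) s
  have e1 : (n : ℂ) + ((s : ℂ) - n - m) = -((m : ℂ) - s) := by ring
  have e2 : (m : ℂ) - s + s - 1 = m - 1 := by ring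
  rw [e1, h5, e2] at h4
  have h6 : Ring.choose ((m : ℂ) - 1) s =
      (-1) ^ s * (Int.negOnePow s • Ring.choose ((m : ℂ) - 1) s) := by
    rw [Int.negOnePow_def, Units.smul_def]
    simp [← mul_assoc, ← mul_pow]
  rw [h6, h4, Finset.mul_sum]
  refine Finset.sum_congr rfl fun ab hab => ?_
  rw [Finset.HasAntidiagonal.mem_antidiagonal] at hab
  rw [hab]
  ring

/-! ### The product on the quotient: two-sided ideal, associativity, unit. -/

/-- The product `*_g` as a bilinear map. -/
def starHom (A : VertexOperatorAlgebra V) (g : V ≃ₗ[ℂ] V) : V →ₗ[ℂ] V →ₗ[ℂ] V :=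
  A.invariantLift g fun n => A.binRes n (-1)

theorem starHom_of_mem (hfin : IsOfFinOrder g) (hn : u ∈ A.weightSpace n) (hu : u ∈ gEigen g 0) :
    A.starHom g u = A.binRes n (-1) u := invariantLift_of_mem _ hfin hn hu

theorem starHom_of_mem_ne_zero (hr0 : r ≠ 0) (hr : r < orderOf g) (hu : u ∈ gEigen g r) :
    A.starHom g u = 0 := invariantLift_of_mem_ne_zero _ hr0 hr hu

theorem starProduct_eq (hg : A.IsAutomorphism g) (hfin : IsOfFinOrder g) (u v : V) :
    A.starProduct g u v = A.starHom g u v := by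
  have h1 : A.starProduct g u v = A.invariantLift g (fun n => (A.binRes n (-1)).flip v) u := by
    rw [invariantLift_eq_finsum]
    refine finsum_congr fun n => ?_
    rw [LinearMap.flip_apply, binRes_apply]
    rfl
  rw [h1]
  refine induction_homogeneous (p := fun u => A.invariantLift g _ u = A.starHom g u v) hg hfin
    (fun n r u hr hn hu => ?_) (by simp) (fun u u' h h' => by simp [h, h']) u
  rcases eq_or_ne r 0 with rfl | hr0
  · rw [starHom_of_mem hfin hn hu, invariantLift_of_mem _ hfin hn hu, LinearMap.flip_apply]
  · rw [starHom_of_mem_ne_zero hr0 hr hu, invariantLift_of_mem_ne_zero _ hr0 hr hu]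
    rfl

theorem starHom_mem_Og_right (hg : A.IsAutomorphism g) (hfin : IsOfFinOrder g) (u : V)
    (hv : v ∈ A.Og g) : A.starHom g u v ∈ A.Og g := by
  refine induction_homogeneous (p := fun u => A.starHom g u v ∈ A.Og g) hg hfin
    (fun n r u hr hn hu => ?_) (by simp) (fun u u' h h' => by simpa using add_mem h h') u
  rcases eq_or_ne r 0 with rfl | hr0
  · rw [starHom_of_mem hfin hn hu]
    exact binRes_mem_Og_of_mem hg hn hu zero_le_one le_rfl (by push_cast; ring) hv
  · simp [starHom_of_mem_ne_zero hr0 hr hu]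

theorem starHom_mem_Og_of_ne_zero (hg : A.IsAutomorphism g) (hfin : IsOfFinOrder g) (u : V)
    (hr0 : r ≠ 0) (hr : r < orderOf g) (hn : v ∈ A.weightSpace n) (hv : v ∈ gEigen g r) :
    A.starHom g u v ∈ A.Og g :=
  starHom_mem_Og_right hg hfin u (mem_Og_of_ne_zero hg hr0 hr hn hv)

/-- Modulo `O_g(V)`, right multiplication by `v ∈ V^0` is `Res_z (1 + z)^{wt v - 1} z⁻¹ Y(v, z)`. -/
theorem mkQ_starHom_eq (hg : A.IsAutomorphism g) (hfin : IsOfFinOrder g) (u : V)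
    (hm : v ∈ A.weightSpace m) (hv : v ∈ gEigen g 0) :
    (A.Og g).mkQ (A.starHom g u v) = (A.Og g).mkQ (A.binRes ((m : ℂ) - 1) (-1) v u) := by
  refine induction_homogeneous (p := fun u => (A.Og g).mkQ (A.starHom g u v) =
    (A.Og g).mkQ (A.binRes ((m : ℂ) - 1) (-1) v u)) hg hfin
    (fun n r u hr hn hu => ?_) (by simp)
    (fun u u' h h' => by simp only [map_add, LinearMap.add_apply, h, h']) u
  rcases eq_or_ne r 0 with rfl | hr0
  · rw [starHom_of_mem hfin hn hu]
    exact mkQ_binRes_skew hg hfin hn hu hm hv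
  · rw [starHom_of_mem_ne_zero hr0 hr hu, LinearMap.zero_apply, map_zero, eq_comm,
      Submodule.mkQ_apply, Submodule.Quotient.mk_eq_zero]
    exact binRes_mem_Og_of_mem hg hm hv le_rfl zero_le_one (by push_cast; ring)
      (mem_Og_of_ne_zero hg hr0 hr hn hu)

/-- For v ∈ V^0, right multiplication becomes a residue operator that preserves O_g(V); for v in
another sector, v itself is in O_g(V). -/
theorem starHom_mem_Og_left (hg : A.IsAutomorphism g) (hfin : IsOfFinOrder g) (v : V)
    (hu : u ∈ A.Og g) : A.starHom g u v ∈ A.Og g := by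
  refine induction_homogeneous (p := fun v => A.starHom g u v ∈ A.Og g) hg hfin
    (fun n r v hr hn hv => ?_) (by simp) (fun v v' h h' => by simpa using add_mem h h') v
  rcases eq_or_ne r 0 with rfl | hr0
  · rw [← Submodule.Quotient.mk_eq_zero, ← Submodule.mkQ_apply, mkQ_starHom_eq hg hfin u hn hv,
      Submodule.mkQ_apply, Submodule.Quotient.mk_eq_zero]
    exact binRes_mem_Og_of_mem hg hn hv le_rfl zero_le_one (by push_cast; ring) hu
  · exact starHom_mem_Og_of_ne_zero hg hfin u hr0 hr hn hv

/-- With w ∈ V^0 fixed, both sides compare left multiplication by u with right multiplication by w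
on v, and these commute modulo O_g(V). -/
theorem mkQ_starHom_assoc (hg : A.IsAutomorphism g) (hfin : IsOfFinOrder g) (u v w : V) :
    (A.Og g).mkQ (A.starHom g (A.starHom g u v) w) =
      (A.Og g).mkQ (A.starHom g u (A.starHom g v w)) := by
  refine induction_homogeneous (p := fun w => (A.Og g).mkQ (A.starHom g (A.starHom g u v) w) =
      (A.Og g).mkQ (A.starHom g u (A.starHom g v w))) hg hfin
    (fun m s w hs hm hw => ?_) (by simp) (fun w w' h h' => by simp only [map_add, h, h']) w
  rcases eq_or_ne s 0 with rfl | hs0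
  · have h1 : (A.Og g).mkQ (A.starHom g u (A.starHom g v w)) =
        (A.Og g).mkQ (A.starHom g u (A.binRes ((m : ℂ) - 1) (-1) w v)) := by
      have h2 := mkQ_starHom_eq hg hfin v hm hw
      rw [← sub_eq_zero, ← map_sub, Submodule.mkQ_apply, Submodule.Quotient.mk_eq_zero] at h2 ⊢
      rw [← map_sub]
      exact starHom_mem_Og_right hg hfin u h2
    rw [mkQ_starHom_eq hg hfin _ hm hw, h1]
    refine induction_homogeneous (p := fun u =>
      (A.Og g).mkQ (A.binRes ((m : ℂ) - 1) (-1) w (A.starHom g u v)) =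
      (A.Og g).mkQ (A.starHom g u (A.binRes ((m : ℂ) - 1) (-1) w v))) hg hfin
      (fun n r u hr hn hu => ?_) (by simp)
      (fun u u' h h' => by simp only [map_add, LinearMap.add_apply, h, h']) u
    rcases eq_or_ne r 0 with rfl | hr0
    · rw [starHom_of_mem hfin hn hu, eq_comm, ← sub_eq_zero, ← map_sub, Submodule.mkQ_apply,
        Submodule.Quotient.mk_eq_zero]
      exact binRes_commutator_mem_Og hg hfin hn hu hm hw v
    · simp [starHom_of_mem_ne_zero hr0 hr hu]
  · have h1 := mem_Og_of_ne_zero hg hs0 hs hm hw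
    have h2 := starHom_mem_Og_right hg hfin (A.starHom g u v) h1
    have h3 := starHom_mem_Og_right hg hfin u (starHom_mem_Og_right hg hfin v h1)
    rw [← Submodule.Quotient.mk_eq_zero] at h2 h3
    rw [Submodule.mkQ_apply, Submodule.mkQ_apply, h2, h3]

theorem binRes_vac_left (P : ℂ) (v : V) : A.binRes P (-1) A.vac v = v := by
  rw [binRes_apply, finsum_eq_single _ 0]
  · simp [mode_vac_vac]
  · intro i hi
    rw [mode_vac_vac, if_neg (by omega), smul_zero]

theorem starHom_vac_left (hg : A.IsAutomorphism g) (hfin : IsOfFinOrder g) (v : V) :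
    A.starHom g A.vac v = v := by
  rw [starHom_of_mem hfin vac_mem_weightSpace (vac_mem_gEigen hg), binRes_vac_left]

theorem mkQ_starHom_vac_right (hg : A.IsAutomorphism g) (hfin : IsOfFinOrder g) (v : V) :
    (A.Og g).mkQ (A.starHom g v A.vac) = (A.Og g).mkQ v := by
  rw [mkQ_starHom_eq hg hfin v vac_mem_weightSpace (vac_mem_gEigen hg), binRes_vac_left]

/-- The product on `A_g(V)` induced by `*_g`. -/
def agMul (hg : A.IsAutomorphism g) (hfin : IsOfFinOrder g) :
    A.Ag g →ₗ[ℂ] A.Ag g →ₗ[ℂ] A.Ag g :=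
  (A.Og g).liftQ (LinearMap.flip ((A.Og g).liftQ ((A.starHom g).compr₂ (A.Og g).mkQ).flip
    fun v hv => by
      ext u
      simpa using starHom_mem_Og_right hg hfin u hv))
    fun u hu => by
      ext v
      exact (Submodule.Quotient.mk_eq_zero _).2 (starHom_mem_Og_left hg hfin v hu)

theorem agMul_mkQ (hg : A.IsAutomorphism g) (hfin : IsOfFinOrder g) (u v : V) :
    agMul hg hfin ((A.Og g).mkQ u) ((A.Og g).mkQ v) = (A.Og g).mkQ (A.starHom g u v) := rfl

end VertexOperatorAlgebra

/-! ### Zero modes on Ω(M) and the representation. -/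

namespace WeakTwistedModule

open VertexOperatorAlgebra

variable {V : Type*} [AddCommGroup V] [Module ℂ V] {A : VertexOperatorAlgebra V}
variable {g : V ≃ₗ[ℂ] V} {M : Type*} [AddCommGroup M] [Module ℂ M] (W : WeakTwistedModule A g M)
variable {n m : ℤ} {r s : ℕ} {u v : V} {w : M}

theorem action_mk (q : ℚ) (a : V) (h : Finsupp.single q a ∈ A.loopSpace g) :
    W.action (Submodule.Quotient.mk ⟨Finsupp.single q a, h⟩) = W.mode a q :=
  W.loopAction_single q a

variable {W} in
theorem mode_eq_zero_of_mem_Omega (hw : w ∈ W.Omega) (hr : r < orderOf g)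
    (hn : u ∈ A.weightSpace n) (hu : u ∈ gEigen g r) {q : ℚ} (hq : (n : ℚ) - q - 1 < 0) :
    W.mode u q w = 0 := by
  by_cases h : ∀ k : ℤ, q ≠ (r : ℚ) / (orderOf g : ℚ) + k
  · rw [W.mode_eq_zero r hr u hu q h, LinearMap.zero_apply]
  · push Not at h
    obtain ⟨k, rfl⟩ := h
    rw [← W.action_mk _ u (Submodule.subset_span ⟨r, k, u, hr, hu, rfl⟩)]
    exact hw _ (Submodule.subset_span ⟨n, r, k, u, hr, hu, hn, hq, rfl⟩)

theorem mem_Omega (h : ∀ (n : ℤ) (r : ℕ) (u : V) (q : ℚ), r < orderOf g → u ∈ A.weightSpace n →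
    u ∈ gEigen g r → (n : ℚ) - q - 1 < 0 → W.mode u q w = 0) : w ∈ W.Omega := by
  intro x hx
  induction hx using Submodule.span_induction with
  | zero => simp
  | add x y _ _ hx hy => simp [hx, hy]
  | smul c x _ hx => simp [hx]
  | mem x hx =>
    obtain ⟨n, r, k, a, hr, ha, hn, hq, rfl⟩ := hx
    exact (LinearMap.congr_fun (W.action_mk _ a _) w).trans (h n r a _ hr hn ha hq)

theorem action_o (hfin : IsOfFinOrder g) (n : ℤ) (a : V) (ha : a ∈ gEigen g 0) :
    W.action (A.o hfin n a ha) = W.mode a ((n - 1 : ℤ) : ℚ) :=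
  W.action_mk _ _ _

/-- The zero mode `o(v) = ∑ (v_n^0)_{n-1}`, where `v_n^0` is the component of `v` in `V_n ∩ V^0`. -/
def zeroMode : V →ₗ[ℂ] Module.End ℂ M :=
  A.invariantLift g fun n => LinearMap.proj ((n - 1 : ℤ) : ℚ) ∘ₗ W.mode

theorem zeroMode_of_mem (hfin : IsOfFinOrder g) (hn : u ∈ A.weightSpace n)
    (hu : u ∈ gEigen g 0) : W.zeroMode u = W.mode u ((n - 1 : ℤ) : ℚ) :=
  invariantLift_of_mem _ hfin hn hu

theorem zeroMode_of_mem_ne_zero (hr0 : r ≠ 0) (hr : r < orderOf g) (hu : u ∈ gEigen g r) :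
    W.zeroMode u = 0 := invariantLift_of_mem_ne_zero _ hr0 hr hu

theorem mode_commutator (hfin : IsOfFinOrder g) (hu : u ∈ gEigen g 0) (k : ℤ) (q : ℚ) (v : V)
    (w : M) : W.mode u k (W.mode v q w) - W.mode v q (W.mode u k w) =
      ∑ᶠ i : ℕ, Ring.choose (k : ℂ) i • W.mode (A.mode u i v) (k + q - i) w := by
  have h := W.jacobi 0 hfin.orderOf_pos u hu v w 0 k k q (by simp)
  rw [finsum_eq_single _ 0, finsum_eq_single _ 0] at h
  · simpa using h
  · intro i hi
    obtain ⟨j, rfl⟩ := Nat.exists_eq_succ_of_ne_zero hi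
    simp [Ring.choose_zero_succ]
  · intro i hi
    obtain ⟨j, rfl⟩ := Nat.exists_eq_succ_of_ne_zero hi
    simp [Ring.choose_zero_succ]

/-- The zero mode has degree 0, so its commutator with a mode of negative degree is a sum of modes
of that same negative degree. -/
theorem mode_mem_Omega (hg : A.IsAutomorphism g) (hfin : IsOfFinOrder g)
    (hn : u ∈ A.weightSpace n) (hu : u ∈ gEigen g 0) (hw : w ∈ W.Omega) :
    W.mode u ((n - 1 : ℤ) : ℚ) w ∈ W.Omega := by
  refine W.mem_Omega fun m s v q hs hm hv hq => ?_
  have h := W.mode_commutator hfin hu (n - 1) q v w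
  rw [mode_eq_zero_of_mem_Omega hw hs hm hv hq, map_zero, finsum_eq_zero_of_forall_eq_zero] at h
  · simpa using h
  · intro i
    have h1 := mode_mem_gEigen hg hu hv (i : ℤ)
    rw [zero_add] at h1
    rw [mode_eq_zero_of_mem_Omega hw hs (mode_mem_weightSpace hn hm _) h1, smul_zero]
    push_cast
    linarith

theorem zeroMode_mem_Omega (hg : A.IsAutomorphism g) (hfin : IsOfFinOrder g) (u : V)
    (hw : w ∈ W.Omega) : W.zeroMode u w ∈ W.Omega := by
  refine induction_homogeneous (p := fun u => W.zeroMode u w ∈ W.Omega) hg hfin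
    (fun n r u hr hn hu => ?_) (by simp) (fun u u' h h' => by simpa using add_mem h h') u
  rcases eq_or_ne r 0 with rfl | hr0
  · rw [W.zeroMode_of_mem hfin hn hu]
    exact W.mode_mem_Omega hg hfin hn hu hw
  · simp [W.zeroMode_of_mem_ne_zero hr0 hr hu]

/-- The right hand side of the Jacobi identity, when all its terms are zero modes. -/
theorem finsum_choose_smul_mode (hg : A.IsAutomorphism g) (hfin : IsOfFinOrder g)
    (hn : u ∈ A.weightSpace n) (hu : u ∈ gEigen g r) (hm : v ∈ A.weightSpace m)
    (hv : v ∈ gEigen g s) (hrs : (r + s) % orderOf g = 0) (P : ℂ) (l : ℤ) {q : ℚ}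
    (hq : q = n + m - l - 2) (w : M) :
    ∑ᶠ i : ℕ, Ring.choose P i • W.mode (A.mode u (l + i) v) (q - i) w =
      W.zeroMode (A.binRes P l u v) w := by
  obtain ⟨N, hN⟩ := (A.eventually_mode_eq_zero u v l).exists
  rw [binRes, A.res_eq_sum hN, finsum_eq_sum_range (N := N), map_sum, LinearMap.sum_apply]
  · refine Finset.sum_congr rfl fun i _ => ?_
    have h1 := mode_mem_gEigen hg hu hv (i + l)
    rw [← gEigen_mod hfin, hrs] at h1
    rw [map_smul, W.zeroMode_of_mem hfin (mode_mem_weightSpace hn hm _) h1, add_comm l,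
      LinearMap.smul_apply, PowerSeries.binomialSeries_coeff, smul_eq_mul, mul_one]
    congr 3
    rw [hq]
    push_cast
    ring_nf
  · intro i hi
    rw [add_comm l, hN i hi]
    simp

/-- If r + s is not divisible by T, the product lies in a sector with no zero mode. Otherwise its
zero mode is the right side of a Jacobi identity whose left side kills w: the inner modes of v have
degree r/T - 1 - i, those of u degree -(r/T + δ_r) - i. -/
theorem zeroMode_circ (hg : A.IsAutomorphism g) (hfin : IsOfFinOrder g) (hr : r < orderOf g)
    (hn : u ∈ A.weightSpace n) (hu : u ∈ gEigen g r) (v : V) (hw : w ∈ W.Omega) :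
    W.zeroMode (A.circ g n r u v) w = 0 := by
  have hT : (0 : ℚ) < orderOf g := Nat.cast_pos.2 hfin.orderOf_pos
  rw [circ_eq_binRes]
  refine induction_homogeneous (p := fun v => W.zeroMode (A.binRes _ _ u v) w = 0) hg hfin
    (fun m s v hs hm hv => ?_) (by simp)
    (fun v v' h h' => by rw [map_add, map_add, LinearMap.add_apply, h, h', add_zero]) v
  by_cases hrs : (r + s) % orderOf g = 0
  · have hr1 : (r : ℚ) / (orderOf g : ℚ) < 1 := by
      rw [div_lt_one hT]
      exact_mod_cast hr
    have hr0 : 0 ≤ (r : ℚ) / (orderOf g : ℚ) := by positivity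
    generalize hδ : (if r = 0 then 1 else 0 : ℤ) = δ
    -- This positivity is the role of δ_r: without it the modes of u for r = 0 would begin in degree
    -- 0.
    have hpos : 0 < (r : ℚ) / (orderOf g : ℚ) + δ := by
      rw [← hδ]
      split_ifs with h
      · push_cast
        linarith
      · have : (0 : ℚ) < r := Nat.cast_pos.2 (Nat.pos_of_ne_zero h)
        push_cast
        positivity
    have h := W.jacobi r hr u hu v w (-1 - δ) (n - 1 + δ)
      ((n : ℚ) - 1 + (r : ℚ) / (orderOf g : ℚ) + δ) (m - (r : ℚ) / (orderOf g : ℚ))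
      (by push_cast; ring)
    rw [finsum_eq_zero_of_forall_eq_zero, finsum_eq_zero_of_forall_eq_zero,
      W.finsum_choose_smul_mode hg hfin hn hu hm hv hrs _ _ (by push_cast; ring), sub_zero] at h
    · rw [h]
      push_cast
      rfl
    · intro i
      rw [mode_eq_zero_of_mem_Omega hw hr hn hu, map_zero, smul_zero]
      have : (0 : ℚ) ≤ i := Nat.cast_nonneg i
      linarith
    · intro i
      rw [mode_eq_zero_of_mem_Omega hw hs hm hv, map_zero, smul_zero]
      have : (0 : ℚ) ≤ i := Nat.cast_nonneg i
      linarith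
  · have h1 : A.binRes ((n : ℂ) - 1 + (r : ℂ) / (orderOf g : ℂ) +
        ((if r = 0 then 1 else 0 : ℤ) : ℂ)) (-1 - (if r = 0 then 1 else 0)) u v ∈
        gEigen g ((r + s) % orderOf g) := by
      rw [gEigen_mod hfin]
      exact A.binRes_mem fun i => mode_mem_gEigen hg hu hv _
    rw [W.zeroMode_of_mem_ne_zero hrs (Nat.mod_lt _ hfin.orderOf_pos) h1, LinearMap.zero_apply]

theorem zeroMode_of_mem_Og (hg : A.IsAutomorphism g) (hfin : IsOfFinOrder g) (hu : u ∈ A.Og g)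
    (hw : w ∈ W.Omega) : W.zeroMode u w = 0 := by
  induction hu using Submodule.span_induction with
  | zero => simp
  | add x y _ _ hx hy => simp [hx, hy]
  | smul c x _ hx => simp [hx]
  | mem x hx =>
    obtain ⟨n, r, u, v, hr, hn, hu, rfl⟩ := hx
    exact W.zeroMode_circ hg hfin hr hn hu v hw

theorem zeroMode_starHom (hg : A.IsAutomorphism g) (hfin : IsOfFinOrder g) (u v : V)
    (hw : w ∈ W.Omega) : W.zeroMode (A.starHom g u v) w = W.zeroMode u (W.zeroMode v w) := by
  refine induction_homogeneous
    (p := fun u => W.zeroMode (A.starHom g u v) w = W.zeroMode u (W.zeroMode v w)) hg hfin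
    (fun n r u hr hn hu => ?_) (by simp) (fun u u' h h' => by simp [h, h']) u
  rcases eq_or_ne r 0 with rfl | hr0
  · refine induction_homogeneous
      (p := fun v => W.zeroMode (A.starHom g u v) w = W.zeroMode u (W.zeroMode v w)) hg hfin
      (fun m s v hs hm hv => ?_) (by simp) (fun v v' h h' => by simp [h, h']) v
    rw [starHom_of_mem hfin hn hu]
    rcases eq_or_ne s 0 with rfl | hs0
    -- The modes u_{n+i} and, for i > 0, v_{m-1+i} kill w, which leaves only o(u)o(v)w on the left.
    · have h := W.jacobi 0 hr u hu v w (-1) n n ((m - 1 : ℤ) : ℚ) (by simp)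
      rw [finsum_eq_single _ 0, finsum_eq_zero_of_forall_eq_zero,
        W.finsum_choose_smul_mode hg hfin hn hu hm hv (by simp) _ _ (by push_cast; ring)] at h
      · rw [W.zeroMode_of_mem hfin hn hu, W.zeroMode_of_mem hfin hm hv]
        simpa [← sub_eq_add_neg] using h.symm
      · intro i
        rw [mode_eq_zero_of_mem_Omega hw hr hn hu, map_zero, smul_zero]
        have : (0 : ℚ) ≤ i := Nat.cast_nonneg i
        linarith
      · intro i hi
        rw [mode_eq_zero_of_mem_Omega hw hs hm hv, map_zero, smul_zero]
        have : (1 : ℚ) ≤ i := Nat.one_le_cast.2 (Nat.pos_of_ne_zero hi)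
        push_cast
        linarith
    · have h1 : A.binRes n (-1) u v ∈ gEigen g s := by
        refine A.binRes_mem fun i => ?_
        have := mode_mem_gEigen hg hu hv (i + -1)
        rwa [zero_add] at this
      rw [W.zeroMode_of_mem_ne_zero hs0 hs h1, W.zeroMode_of_mem_ne_zero hs0 hs hv]
      simp
  · simp [starHom_of_mem_ne_zero hr0 hr hu, W.zeroMode_of_mem_ne_zero hr0 hr hu]

/-- The action of `V` on `Ω(M)` by zero modes. -/
def zeroModeOmega (hg : A.IsAutomorphism g) (hfin : IsOfFinOrder g) :
    V →ₗ[ℂ] Module.End ℂ W.Omega where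
  toFun u := (W.zeroMode u).restrict fun _ hw => W.zeroMode_mem_Omega hg hfin u hw
  map_add' u v := by
    ext w
    simp
  map_smul' c u := by
    ext w
    simp

/-- The representation of `A_g(V)` on `Ω(M)`. -/
def agRep (hg : A.IsAutomorphism g) (hfin : IsOfFinOrder g) :
    A.Ag g →ₗ[ℂ] Module.End ℂ W.Omega :=
  (A.Og g).liftQ (W.zeroModeOmega hg hfin) fun u hu => by
    ext w
    exact W.zeroMode_of_mem_Og hg hfin hu w.2

theorem coe_agRep_mkQ (hg : A.IsAutomorphism g) (hfin : IsOfFinOrder g) (u : V) (w : W.Omega) :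
    (W.agRep hg hfin ((A.Og g).mkQ u) w : M) = W.zeroMode u w := rfl

end WeakTwistedModule

end

/-! ### The theorem. -/

open VertexOperatorAlgebra WeakTwistedModule in
theorem theorem5p3 {V : Type*} [AddCommGroup V] [Module ℂ V] (A : VertexOperatorAlgebra V)
    (g : V ≃ₗ[ℂ] V) (hg : A.IsAutomorphism g) (hfin : IsOfFinOrder g)
    {M : Type*} [AddCommGroup M] [Module ℂ M] (W : WeakTwistedModule A g M) :
    -- the associative unital product induced on the quotient by the product on `V`
    ∃ mul : A.Ag g →ₗ[ℂ] A.Ag g →ₗ[ℂ] A.Ag g,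
      (∀ u v : V, mul ((A.Og g).mkQ u) ((A.Og g).mkQ v) = (A.Og g).mkQ (A.starProduct g u v)) ∧
      (∀ x y z : A.Ag g, mul (mul x y) z = mul x (mul y z)) ∧
      (∀ x : A.Ag g, mul ((A.Og g).mkQ A.vac) x = x ∧ mul x ((A.Og g).mkQ A.vac) = x) ∧
      -- the representation
      ∃ ρ : A.Ag g →ₗ[ℂ] Module.End ℂ W.Omega,
        ρ ((A.Og g).mkQ A.vac) = 1 ∧
        (∀ x y : A.Ag g, ρ (mul x y) = ρ x * ρ y) ∧
        ∀ (n : ℤ) (a : V) (ha : a ∈ gEigen g 0), a ∈ A.weightSpace n →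
          ∀ w : W.Omega, (ρ ((A.Og g).mkQ a) w : M) = W.action (A.o hfin n a ha) w := by
  have hsurj := (A.Og g).mkQ_surjective
  refine ⟨agMul hg hfin, fun u v => ?_, fun x y z => ?_, fun x => ?_, W.agRep hg hfin, ?_,
    fun x y => ?_, fun n a ha hn w => ?_⟩
  · rw [agMul_mkQ, starProduct_eq hg hfin]
  · obtain ⟨u, rfl⟩ := hsurj x
    obtain ⟨v, rfl⟩ := hsurj y
    obtain ⟨w, rfl⟩ := hsurj z
    simp only [agMul_mkQ, mkQ_starHom_assoc hg hfin]
  · obtain ⟨u, rfl⟩ := hsurj x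
    rw [agMul_mkQ, agMul_mkQ, starHom_vac_left hg hfin, mkQ_starHom_vac_right hg hfin]
    exact ⟨rfl, rfl⟩
  · ext w
    rw [coe_agRep_mkQ, W.zeroMode_of_mem hfin vac_mem_weightSpace (vac_mem_gEigen hg), W.vac_mode,
      if_pos (by norm_num)]
    rfl
  · obtain ⟨u, rfl⟩ := hsurj x
    obtain ⟨v, rfl⟩ := hsurj y
    ext w
    rw [agMul_mkQ, coe_agRep_mkQ, W.zeroMode_starHom hg hfin u v w.2]
    rfl
  · rw [coe_agRep_mkQ, W.zeroMode_of_mem hfin hn ha, W.action_o]
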